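/- Let $\mathcal C$ be a braided monoidal category with braiding $\Psi$, in which all idempotents split, and let $(H,m,\eta,\Delta,\varepsilon,S)$ be a Hopf algebra in $\mathcal C$ whose antipode $S$ is an isomorphism. (Associativity and unit constraints of $\mathcal C$ are suppressed in the formulas.) A *right crossed module* (right-right Yetter–Drinfeld module) over $H$ is an object $V$ with a right $H$-module structure $\mu_r:V\otimes H\to V$ and a right $H$-comodule structure $\nu_r:V\to V\otimes H$ such that $$(\mathrm{id}_V\otimes m)(\Psi_{H,V}\otimes \mathrm{id}_H)(\mathrm{id}_H\otimes \nu_r\mu_r)(\Psi_{V,H}\otimes \mathrm{id}_H)(\mathrm{id}_V\otimes\Delta)=(\mu_r\otimes m)(\mathrm{id}_V\otimes\Psi_{H,H}\otimes \mathrm{id}_H)(\nu_r\otimes\Delta).$$ Morphisms are the morphisms of modules and comodules; the category is denoted $\mathcal{DY}(\mathcal C)^H_H$. An *$H$-Hopf bimodule* is an $H$-bimodule $(M,\mu_l,\mu_r)$ and $H$-bicomodule $(M,\nu_l,\nu_r)$ such that $\nu_l:M\to H\otimes M$ and $\nu_r:M\to M\otimes H$ are bimodule morphisms, where $H$ has the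 regular actions and tensor products have the diagonal actions. Morphisms are the bimodule and bicomodule morphisms; the category is denoted ${}^H_H\mathcal C^H_H$. The diagonal right action and coaction on $X\otimes Y$ are $(\mu_r\otimes\mu_r)(\mathrm{id}_X\otimes\Psi_{Y,H}\otimes \mathrm{id}_H)(\mathrm{id}_X\otimes\mathrm{id}_Y\otimes\Delta)$ and $(\mathrm{id}_X\otimes\mathrm{id}_Y\otimes m)(\mathrm{id}_X\otimes\Psi_{H,Y}\otimes \mathrm{id}_H)(\nu_r\otimes\nu_r)$. For a Hopf bimodule $M$ let $\Pi_M=\mu_l(S\otimes \mathrm{id}_M)\nu_l:M\to M$. Then the following hold. 1. For every Hopf bimodule $M$ the endomorphism $\Pi_M$ splits: there are an object ${}_HM$ and morphisms $i_M:{}_HM\to M$, $p_M:M\to{}_HM$ with $p_Mi_M=\mathrm{id}$ and $i_Mp_M=\Pi_M$. Fix any choice of such splittings. 2. $\mathcal{DY}(\mathcal C)^H_H$ is a braided monoidal category: the unit object is $(\mathbf 1,\varepsilon,\eta)$, the tensor product is that of $\mathcal C$ with the diagonal action and coaction, the constraints are those of $\mathcal C$, and the braiding is $(\mathrm{id}_W\otimes\mu_r^V)(\Psi_{V,W}\otimes\mathrm{id}_H)(\mathrm{id}_V\otimes\nu_r^W):V\otimes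 W\to W\otimes V$. 3. If $M$ is a Hopf bimodule and $V$ a crossed module, then $M\otimes V$, with the left action and left coaction of $M$ and the diagonal right action and coaction, is a Hopf bimodule. In particular $H\ltimes V=H\otimes V$, $H\ltimes f=\mathrm{id}_H\otimes f$ defines a functor $H\ltimes(-):\mathcal{DY}(\mathcal C)^H_H\to{}^H_H\mathcal C^H_H$. For a Hopf bimodule $M$ the object ${}_HM$ is a crossed module with action $p_M\mu_r(i_M\otimes\mathrm{id}_H)$ and coaction $(p_M\otimes\mathrm{id}_H)\nu_ri_M$, and with ${}_H(f)=p_N f i_M$ for $f:M\to N$ this defines a functor ${}_H(-):{}^H_H\mathcal C^H_H\to\mathcal{DY}(\mathcal C)^H_H$. 4. ${}^H_H\mathcal C^H_H$ is a braided monoidal category with tensor product $M\otimes_HN=M\otimes{}_HN$, $f\otimes_H g=f\otimes{}_H(g)$, with unit object $H$, and with the constraints induced by the isomorphisms $p_{M\otimes{}_HN}(i_M\otimes\mathrm{id}):{}_HM\otimes{}_HN\to{}_H(M\otimes{}_HN)$ and $\varepsilon i_H:{}_HH\to\mathbf 1$ of crossed modules and the isomorphism $\mu_l(\mathrm{id}_H\otimes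 i_M):H\otimes{}_HM\to M$ of Hopf bimodules; the braiding is $$(\mu_l^N\otimes p_M\mu_r^M)(\mathrm{id}_H\otimes\Psi_{M,N}\otimes\mathrm{id}_H)(\nu_l^M\otimes\nu_r^Ni_N):M\otimes{}_HN\to N\otimes{}_HM.$$ 5. There is an equivalence of braided monoidal categories $\mathcal{DY}(\mathcal C)^H_H\simeq{}^H_H\mathcal C^H_H$ given by the mutually quasi-inverse functors $H\ltimes(-)$ and ${}_H(-)$: both carry braided strong monoidal structures, and the unit and counit of the equivalence are monoidal. -/

import Mathlib

open CategoryTheory MonoidalCategory BraidedCategory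
open scoped MonObj ComonObj HopfObj

set_option linter.unusedSectionVars false

noncomputable section

namespace BraidedHopf

universe v u
variable {C : Type u} [Category.{v} C] [MonoidalCategory C]

/-- `act` makes `X` a unital associative right `A`-module. -/
structure IsRightModule (A : C) [MonObj A] {X : C} (act : X ⊗ A ⟶ X) : Prop where
  one_act : X ◁ η ≫ act = (ρ_ X).hom
  act_act : act ▷ A ≫ act = (α_ X A A).hom ≫ X ◁ μ ≫ act

/-- `act` makes `X` a unital associative left `A`-module. -/
structure IsLeftModule (A : C) [MonObj A] {X : C} (act : A ⊗ X ⟶ X) : Prop where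
  one_act : η ▷ X ≫ act = (λ_ X).hom
  act_act : A ◁ act ≫ act = (α_ A A X).inv ≫ μ ▷ X ≫ act

/-- `coact` makes `X` a counital coassociative right `A`-comodule. -/
structure IsRightComodule (A : C) [ComonObj A] {X : C} (coact : X ⟶ X ⊗ A) : Prop where
  coact_counit : coact ≫ X ◁ ε = (ρ_ X).inv
  coact_coact : coact ≫ coact ▷ A = coact ≫ X ◁ Δ ≫ (α_ X A A).inv

/-- `coact` makes `X` a counital coassociative left `A`-comodule. -/
structure IsLeftComodule (A : C) [ComonObj A] {X : C} (coact : X ⟶ A ⊗ X) : Prop where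
  coact_counit : coact ≫ ε ▷ X = (λ_ X).inv
  coact_coact : coact ≫ A ◁ coact = coact ≫ Δ ▷ X ≫ (α_ A A X).hom

/-- The left action on `X ⊗ Y` induced by a left action on `X`. -/
def inducedLeftAct {A X : C} (a : A ⊗ X ⟶ X) (Y : C) : A ⊗ (X ⊗ Y) ⟶ X ⊗ Y :=
  (α_ A X Y).inv ≫ a ▷ Y

/-- The left coaction on `X ⊗ Y` induced by a left coaction on `X`. -/
def inducedLeftCoact {A X : C} (a : X ⟶ A ⊗ X) (Y : C) : X ⊗ Y ⟶ A ⊗ (X ⊗ Y) :=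
  a ▷ Y ≫ (α_ A X Y).hom

lemma inducedLeftAct_natural {A X X' Y Y' : C} {a : A ⊗ X ⟶ X} {a' : A ⊗ X' ⟶ X'}
    {f : X ⟶ X'} (g : Y ⟶ Y') (hf : a ≫ f = A ◁ f ≫ a') :
    inducedLeftAct a Y ≫ (f ⊗ₘ g) = A ◁ (f ⊗ₘ g) ≫ inducedLeftAct a' Y' := by
  simp only [inducedLeftAct, Category.assoc, MonoidalCategory.tensorHom_def,
    ← comp_whiskerRight_assoc, hf]
  rw [comp_whiskerRight, Category.assoc, ← whisker_exchange]
  simp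

lemma inducedLeftCoact_natural {A X X' Y Y' : C} {a : X ⟶ A ⊗ X} {a' : X' ⟶ A ⊗ X'}
    {f : X ⟶ X'} (g : Y ⟶ Y') (hf : a ≫ A ◁ f = f ≫ a') :
    inducedLeftCoact a Y ≫ A ◁ (f ⊗ₘ g) = (f ⊗ₘ g) ≫ inducedLeftCoact a' Y' := by
  have e : (f ≫ a') ▷ Y = a ▷ Y ≫ (A ◁ f) ▷ Y := by rw [← hf, comp_whiskerRight]
  simp only [inducedLeftCoact, Category.assoc, MonoidalCategory.tensorHom_def,
    whisker_exchange_assoc]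
  rw [← comp_whiskerRight_assoc, e]
  simp

lemma inducedLeftAct_assoc {A X : C} (a : A ⊗ X ⟶ X) (Y Z : C) :
    inducedLeftAct (inducedLeftAct a Y) Z ≫ (α_ X Y Z).hom =
      A ◁ (α_ X Y Z).hom ≫ inducedLeftAct a (Y ⊗ Z) := by
  simp [inducedLeftAct]

lemma inducedLeftCoact_assoc {A X : C} (a : X ⟶ A ⊗ X) (Y Z : C) :
    inducedLeftCoact (inducedLeftCoact a Y) Z ≫ A ◁ (α_ X Y Z).hom =
      (α_ X Y Z).hom ≫ inducedLeftCoact a (Y ⊗ Z) := by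
  simp [inducedLeftCoact]

lemma inducedLeftAct_rho {A X : C} (a : A ⊗ X ⟶ X) :
    inducedLeftAct a (𝟙_ C) ≫ (ρ_ X).hom = A ◁ (ρ_ X).hom ≫ a := by
  simp [inducedLeftAct]

lemma inducedLeftCoact_rho {A X : C} (a : X ⟶ A ⊗ X) :
    inducedLeftCoact a (𝟙_ C) ≫ A ◁ (ρ_ X).hom = (ρ_ X).hom ≫ a := by
  simp [inducedLeftCoact]

variable [BraidedCategory C]

/-- The diagonal right action
`(a ⊗ b) ∘ (id_X ⊗ Ψ_{Y,A} ⊗ id_A) ∘ (id_X ⊗ id_Y ⊗ Δ)` on `X ⊗ Y`. -/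
def diagRightAct {A : C} [ComonObj A] {X Y : C} (a : X ⊗ A ⟶ X) (b : Y ⊗ A ⟶ Y) :
    (X ⊗ Y) ⊗ A ⟶ X ⊗ Y :=
  (X ⊗ Y) ◁ Δ ≫ tensorμ X Y A A ≫ (a ⊗ₘ b)

/-- The diagonal right coaction
`(id_X ⊗ id_Y ⊗ m) ∘ (id_X ⊗ Ψ_{A,Y} ⊗ id_A) ∘ (a ⊗ b)` on `X ⊗ Y`. -/
def diagRightCoact {A : C} [MonObj A] {X Y : C} (a : X ⟶ X ⊗ A) (b : Y ⟶ Y ⊗ A) :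
    X ⊗ Y ⟶ (X ⊗ Y) ⊗ A :=
  (a ⊗ₘ b) ≫ tensorμ X A Y A ≫ (X ⊗ Y) ◁ μ

lemma diagRightAct_natural {A : C} [ComonObj A] {X Y X' Y' : C} {a : X ⊗ A ⟶ X} {b : Y ⊗ A ⟶ Y}
    {a' : X' ⊗ A ⟶ X'} {b' : Y' ⊗ A ⟶ Y'} {f : X ⟶ X'} {g : Y ⟶ Y'}
    (hf : a ≫ f = f ▷ A ≫ a') (hg : b ≫ g = g ▷ A ≫ b') :
    diagRightAct a b ≫ (f ⊗ₘ g) = (f ⊗ₘ g) ▷ A ≫ diagRightAct a' b' := by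
  simp only [diagRightAct, Category.assoc, tensorHom_comp_tensorHom, hf, hg]
  rw [← whisker_exchange_assoc, tensorμ_natural_left_assoc, tensorHom_comp_tensorHom]

lemma diagRightCoact_natural {A : C} [MonObj A] {X Y X' Y' : C} {a : X ⟶ X ⊗ A} {b : Y ⟶ Y ⊗ A}
    {a' : X' ⟶ X' ⊗ A} {b' : Y' ⟶ Y' ⊗ A} {f : X ⟶ X'} {g : Y ⟶ Y'}
    (hf : a ≫ f ▷ A = f ≫ a') (hg : b ≫ g ▷ A = g ≫ b') :
    diagRightCoact a b ≫ (f ⊗ₘ g) ▷ A = (f ⊗ₘ g) ≫ diagRightCoact a' b' := by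
  simp only [diagRightCoact, Category.assoc, whisker_exchange]
  rw [tensorHom_comp_tensorHom_assoc, ← hf, ← hg, ← tensorHom_comp_tensorHom_assoc,
    ← tensorHom_id f A, ← tensorHom_id g A, tensorμ_natural_assoc]
  simp

lemma diagRightAct_assoc {A : C} [ComonObj A] {X Y Z : C} (a : X ⊗ A ⟶ X) (b : Y ⊗ A ⟶ Y)
    (c : Z ⊗ A ⟶ Z) :
    diagRightAct (diagRightAct a b) c ≫ (α_ X Y Z).hom =
      (α_ X Y Z).hom ▷ A ≫ diagRightAct a (diagRightAct b c) := by
  have e1 : diagRightAct a b ⊗ₘ c = (((X ⊗ Y) ◁ Δ) ⊗ₘ (Z ◁ 𝟙 A)) ≫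
      (tensorμ X Y A A ▷ (Z ⊗ A)) ≫ ((a ⊗ₘ b) ⊗ₘ c) := by
    rw [← tensorHom_id (tensorμ X Y A A)]
    simp only [diagRightAct, tensorHom_comp_tensorHom, MonoidalCategory.whiskerLeft_id,
      Category.id_comp]
  have e2 : a ⊗ₘ diagRightAct b c = ((X ◁ 𝟙 A) ⊗ₘ ((Y ⊗ Z) ◁ Δ)) ≫
      ((X ⊗ A) ◁ tensorμ Y Z A A) ≫ (a ⊗ₘ (b ⊗ₘ c)) := by
    rw [← id_tensorHom (X ⊗ A)]
    simp only [diagRightAct, tensorHom_comp_tensorHom, MonoidalCategory.whiskerLeft_id,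
      Category.id_comp]
  unfold diagRightAct at e1 e2 ⊢
  rw [e1, e2]
  simp only [Category.assoc]
  rw [← tensorμ_natural_right_assoc, ← tensorμ_natural_right_assoc, associator_naturality,
    reassoc_of% (associator_monoidal X Y Z A A A), tensorHom_id, id_tensorHom,
    ← MonoidalCategory.whiskerLeft_comp_assoc, ← MonoidalCategory.whiskerLeft_comp_assoc,
    ComonObj.comul_assoc, MonoidalCategory.tensorHom_def', ← Category.assoc (Δ : A ⟶ A ⊗ A),
    MonoidalCategory.whiskerLeft_comp]
  simp only [Category.assoc, whisker_exchange_assoc, MonoidalCategory.whiskerLeft_comp]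

lemma diagRightCoact_assoc {A : C} [MonObj A] {X Y Z : C} (a : X ⟶ X ⊗ A) (b : Y ⟶ Y ⊗ A)
    (c : Z ⟶ Z ⊗ A) :
    diagRightCoact (diagRightCoact a b) c ≫ (α_ X Y Z).hom ▷ A =
      (α_ X Y Z).hom ≫ diagRightCoact a (diagRightCoact b c) := by
  have e1 : diagRightCoact a b ⊗ₘ c = ((a ⊗ₘ b) ⊗ₘ c) ≫
      (tensorμ X A Y A ▷ (Z ⊗ A)) ≫ ((𝟙 (X ⊗ Y) ⊗ₘ μ) ▷ (Z ⊗ A)) := by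
    rw [← tensorHom_id (tensorμ X A Y A), ← tensorHom_id (𝟙 (X ⊗ Y) ⊗ₘ μ)]
    simp only [diagRightCoact, tensorHom_comp_tensorHom, Category.comp_id, id_tensorHom]
  have e2 : a ⊗ₘ diagRightCoact b c = (a ⊗ₘ (b ⊗ₘ c)) ≫
      ((X ⊗ A) ◁ tensorμ Y A Z A) ≫ ((X ⊗ A) ◁ (𝟙 (Y ⊗ Z) ⊗ₘ μ)) := by
    rw [← id_tensorHom (X ⊗ A) (tensorμ Y A Z A), ← id_tensorHom (X ⊗ A) (𝟙 (Y ⊗ Z) ⊗ₘ μ),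
      tensorHom_comp_tensorHom, tensorHom_comp_tensorHom, Category.comp_id, Category.comp_id,
      diagRightCoact, id_tensorHom]
  have h3 := tensor_associativity X A Y A Z A
  unfold diagRightCoact at e1 e2 ⊢
  rw [e1, e2]
  simp only [Category.assoc]
  rw [tensorμ_natural_left_assoc, tensorμ_natural_right_assoc, ← associator_naturality_assoc,
    ← reassoc_of% h3, MonoidalCategory.id_whiskerRight, MonoidalCategory.whiskerLeft_id,
    id_tensorHom, id_tensorHom, ← MonoidalCategory.whiskerLeft_comp_assoc,
    ← MonoidalCategory.whiskerLeft_comp, MonObj.mul_assoc, MonoidalCategory.tensorHom_def (α_ X Y Z).hom]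
  simp only [MonoidalCategory.whiskerLeft_comp, Category.assoc, whisker_exchange_assoc,
    whisker_exchange]

lemma diagRightAct_lambda {A : C} [ComonObj A] {X : C} (a : X ⊗ A ⟶ X) :
    diagRightAct ((λ_ A).hom ≫ ε) a ≫ (λ_ X).hom = (λ_ X).hom ▷ A ≫ a := by
  have e : ((λ_ A).hom ≫ ε) ⊗ₘ a = ((𝟙_ C) ◁ ε ⊗ₘ X ◁ 𝟙 A) ≫ ((λ_ _).hom ⊗ₘ a) := by
    simp only [tensorHom_comp_tensorHom, MonoidalCategory.whiskerLeft_id, Category.id_comp,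
      leftUnitor_naturality]
  rw [diagRightAct, e]
  simp only [Category.assoc]
  rw [← tensorμ_natural_right_assoc, tensorHom_id, ← MonoidalCategory.whiskerLeft_comp_assoc,
    ComonObj.counit_comul]
  have e : ((λ_ (𝟙_ C)).hom ⊗ₘ a) = ((λ_ (𝟙_ C)).hom ▷ _) ≫ (𝟙_ C) ◁ a :=
    MonoidalCategory.tensorHom_def _ _
  simp [e, tensorμ]

lemma diagRightAct_rho {A : C} [ComonObj A] {X : C} (a : X ⊗ A ⟶ X) :
    diagRightAct a ((λ_ A).hom ≫ ε) ≫ (ρ_ X).hom = (ρ_ X).hom ▷ A ≫ a := by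
  have e : a ⊗ₘ ((λ_ A).hom ≫ ε) = (X ◁ 𝟙 A ⊗ₘ (𝟙_ C) ◁ ε) ≫ (a ⊗ₘ (λ_ _).hom) := by
    simp only [tensorHom_comp_tensorHom, MonoidalCategory.whiskerLeft_id, Category.id_comp,
      leftUnitor_naturality]
  rw [diagRightAct, e]
  simp only [Category.assoc]
  rw [← tensorμ_natural_right_assoc, id_tensorHom, ← MonoidalCategory.whiskerLeft_comp_assoc,
    ComonObj.comul_counit, MonoidalCategory.tensorHom_def']
  simp only [tensorμ, Category.assoc, braiding_tensorUnit_left, comp_whiskerRight,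
    MonoidalCategory.whiskerLeft_comp, rightUnitor_naturality]
  simp only [← Category.assoc]
  congr 1
  monoidal

lemma diagRightCoact_lambda {A : C} [MonObj A] {X : C} (a : X ⟶ X ⊗ A) :
    diagRightCoact (η ≫ (λ_ A).inv) a ≫ (λ_ X).hom ▷ A = (λ_ X).hom ≫ a := by
  have e : (η ≫ (λ_ A).inv) ⊗ₘ a =
      ((λ_ _).inv ⊗ₘ a) ≫ ((𝟙 (𝟙_ C) ⊗ₘ η) ⊗ₘ (𝟙 X ⊗ₘ 𝟙 A)) := by
    rw [tensorHom_comp_tensorHom, id_tensorHom, leftUnitor_inv_naturality]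
    simp
  rw [diagRightCoact, e]
  simp only [Category.assoc]
  rw [tensorμ_natural_assoc, id_tensorHom, tensorHom_id, MonoidalCategory.whiskerLeft_id,
    id_tensorHom, ← MonoidalCategory.whiskerLeft_comp_assoc, MonObj.one_mul]
  simp only [tensorμ, Category.assoc, braiding_tensorUnit_left, comp_whiskerRight,
    MonoidalCategory.whiskerLeft_comp, MonoidalCategory.tensorHom_def]
  rw [← leftUnitor_naturality]
  monoidal

lemma diagRightCoact_rho {A : C} [MonObj A] {X : C} (a : X ⟶ X ⊗ A) :
    diagRightCoact a (η ≫ (λ_ A).inv) ≫ (ρ_ X).hom ▷ A = (ρ_ X).hom ≫ a := by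
  have e : a ⊗ₘ (η ≫ (λ_ A).inv) =
      (a ⊗ₘ (λ_ _).inv) ≫ ((𝟙 X ⊗ₘ 𝟙 A) ⊗ₘ (𝟙 (𝟙_ C) ⊗ₘ η)) := by
    rw [tensorHom_comp_tensorHom, id_tensorHom (𝟙_ C), leftUnitor_inv_naturality]
    simp
  rw [diagRightCoact, e]
  simp only [Category.assoc]
  rw [tensorμ_natural_assoc, id_tensorHom A, id_tensorHom X, MonoidalCategory.whiskerLeft_id,
    id_tensorHom, ← MonoidalCategory.whiskerLeft_comp_assoc, MonObj.mul_one]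
  simp only [tensorμ, Category.assoc, braiding_tensorUnit_right, comp_whiskerRight,
    MonoidalCategory.whiskerLeft_comp, MonoidalCategory.tensorHom_def']
  rw [← rightUnitor_naturality]
  monoidal

lemma diagRightAct_conj {A : C} [ComonObj A] {X X' Y : C} (f : X' ⟶ X) (a : X ⊗ A ⟶ X)
    (g : X ⟶ X') (b : Y ⊗ A ⟶ Y) :
    diagRightAct (f ▷ A ≫ a ≫ g) b = (f ▷ Y) ▷ A ≫ diagRightAct a b ≫ g ▷ Y := by
  have e : (f ▷ A ≫ a ≫ g) ⊗ₘ b = (f ▷ A ⊗ₘ (𝟙 Y) ▷ A) ≫ (a ⊗ₘ b) ≫ (g ⊗ₘ 𝟙 Y) := by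
    rw [tensorHom_comp_tensorHom, tensorHom_comp_tensorHom]
    simp
  rw [diagRightAct, e, ← tensorμ_natural_left_assoc, tensorHom_id, tensorHom_id,
    whisker_exchange_assoc]
  simp only [diagRightAct, Category.assoc]

lemma diagRightCoact_conj {A : C} [MonObj A] {X X' Y : C} (f : X' ⟶ X) (a : X ⟶ X ⊗ A)
    (g : X ⟶ X') (b : Y ⟶ Y ⊗ A) :
    diagRightCoact (f ≫ a ≫ g ▷ A) b = f ▷ Y ≫ diagRightCoact a b ≫ (g ▷ Y) ▷ A := by
  have e : (f ≫ a ≫ g ▷ A) ⊗ₘ b = (f ⊗ₘ 𝟙 Y) ≫ (a ⊗ₘ b) ≫ ((g ⊗ₘ 𝟙 A) ⊗ₘ (𝟙 Y ⊗ₘ 𝟙 A)) := by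
    rw [tensorHom_comp_tensorHom, tensorHom_comp_tensorHom]
    simp
  rw [diagRightCoact, e]
  simp only [Category.assoc]
  rw [tensorμ_natural_assoc, tensorHom_id, id_tensorHom_id, tensorHom_id, tensorHom_id,
    ← whisker_exchange]
  simp only [diagRightCoact, Category.assoc]

section Splitting

variable {X I V J : C} {i : I ⟶ X} {r : X ⟶ I} {j : J ⟶ X ⊗ V} {s : X ⊗ V ⟶ J}

lemma split_hom_inv (hir : i ≫ r = 𝟙 I) (hsj : s ≫ j = (r ≫ i) ▷ V) :
    (i ▷ V ≫ s) ≫ j ≫ r ▷ V = 𝟙 (I ⊗ V) := by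
  rw [Category.assoc, reassoc_of% hsj, ← comp_whiskerRight, ← comp_whiskerRight, Category.assoc,
    hir, Category.comp_id, hir, id_whiskerRight]

lemma split_inv_hom (hjs : j ≫ s = 𝟙 J) (hsj : s ≫ j = (r ≫ i) ▷ V) :
    (j ≫ r ▷ V) ≫ i ▷ V ≫ s = 𝟙 J := by
  rw [Category.assoc, ← comp_whiskerRight_assoc, ← hsj, Category.assoc, hjs, Category.comp_id, hjs]

lemma split_act {A : C} [ComonObj A] (a : X ⊗ A ⟶ X) (b : V ⊗ A ⟶ V) (hir : i ≫ r = 𝟙 I)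
    (hjs : j ≫ s = 𝟙 J) (hsj : s ≫ j = (r ≫ i) ▷ V) :
    diagRightAct (i ▷ A ≫ a ≫ r) b ≫ i ▷ V ≫ s =
      (i ▷ V ≫ s) ▷ A ≫ j ▷ A ≫ diagRightAct a b ≫ s := by
  rw [diagRightAct_conj, Category.assoc, Category.assoc, ← comp_whiskerRight_assoc r i,
    ← comp_whiskerRight_assoc _ j, ← hsj, Category.assoc, hjs, Category.comp_id, Category.assoc,
    hsj, ← comp_whiskerRight, reassoc_of% hir]

lemma split_coact {A : C} [MonObj A] (a : X ⟶ X ⊗ A) (b : V ⟶ V ⊗ A) (hir : i ≫ r = 𝟙 I)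
    (hjs : j ≫ s = 𝟙 J) (hsj : s ≫ j = (r ≫ i) ▷ V) :
    diagRightCoact (i ≫ a ≫ r ▷ A) b ≫ (i ▷ V ≫ s) ▷ A =
      (i ▷ V ≫ s) ≫ j ≫ diagRightCoact a b ≫ s ▷ A := by
  rw [diagRightCoact_conj, Category.assoc, Category.assoc, Category.assoc, ← comp_whiskerRight,
    ← comp_whiskerRight_assoc r i, ← hsj, Category.assoc, hjs, Category.comp_id, reassoc_of% hsj,
    ← comp_whiskerRight_assoc i, reassoc_of% hir]

end Splitting

/-! ### Crossed modules -/

/-- The axioms of a right crossed module (right-right Yetter-Drinfeld module) over a bialgebra: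
a right module and a right comodule whose action and coaction satisfy
`(id ⊗ m)(Ψ_{B,X} ⊗ id)(id ⊗ coact ∘ act)(Ψ_{X,B} ⊗ id)(id ⊗ Δ)
  = (act ⊗ m)(id ⊗ Ψ_{B,B} ⊗ id)(coact ⊗ Δ)`. -/
structure IsCrossedModule (B : C) [BimonObj B] {X : C} (act : X ⊗ B ⟶ X) (coact : X ⟶ X ⊗ B) :
    Prop where
  isRightModule : IsRightModule B act
  isRightComodule : IsRightComodule B coact
  compatibility :
    X ◁ Δ ≫ (α_ X B B).inv ≫ (β_ X B).hom ▷ B ≫ (α_ B X B).hom ≫ B ◁ (act ≫ coact) ≫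
        (α_ B X B).inv ≫ (β_ B X).hom ▷ B ≫ (α_ X B B).hom ≫ X ◁ μ =
      (coact ⊗ₘ Δ) ≫ tensorμ X B B B ≫ (act ⊗ₘ μ)

/-- Right crossed modules (right-right Yetter-Drinfeld modules) over the bialgebra `B`. -/
structure CrossedModule (B : C) [BimonObj B] where
  /-- The underlying object. -/
  X : C
  /-- The right action. -/
  act : X ⊗ B ⟶ X
  /-- The right coaction. -/
  coact : X ⟶ X ⊗ B
  isCrossedModule : IsCrossedModule B act coact

namespace CrossedModule

variable {B : C} [BimonObj B]

/-- Morphisms of crossed modules are the module and comodule morphisms. -/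
@[ext]
structure Hom (V W : CrossedModule B) where
  /-- The underlying morphism. -/
  hom : V.X ⟶ W.X
  act_hom : V.act ≫ hom = hom ▷ B ≫ W.act
  coact_hom : V.coact ≫ hom ▷ B = hom ≫ W.coact

instance : Category (CrossedModule B) where
  Hom V W := Hom V W
  id V := ⟨𝟙 V.X, by simp, by simp⟩
  comp f g := ⟨f.hom ≫ g.hom,
    by rw [reassoc_of% f.act_hom, g.act_hom]; simp,
    by rw [comp_whiskerRight, reassoc_of% f.coact_hom, g.coact_hom]; simp⟩

@[ext]
lemma hom_ext {V W : CrossedModule B} {f g : V ⟶ W} (h : f.hom = g.hom) : f = g :=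
  Hom.ext h

@[simp] lemma id_hom (V : CrossedModule B) : Hom.hom (𝟙 V) = 𝟙 V.X := rfl

@[simp] lemma comp_hom {U V W : CrossedModule B} (f : U ⟶ V) (g : V ⟶ W) :
    (f ≫ g).hom = f.hom ≫ g.hom := rfl

/-- An isomorphism of underlying objects that is a morphism of crossed modules is an isomorphism
of crossed modules. -/
@[simps]
def isoMk {V W : CrossedModule B} (f : V.X ≅ W.X) (h₁ : V.act ≫ f.hom = f.hom ▷ B ≫ W.act)
    (h₂ : V.coact ≫ f.hom ▷ B = f.hom ≫ W.coact) : V ≅ W where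
  hom := ⟨f.hom, h₁, h₂⟩
  inv := ⟨f.inv, by rw [Iso.comp_inv_eq, Category.assoc, h₁]; simp [← comp_whiskerRight_assoc],
    by rw [Iso.eq_inv_comp, ← reassoc_of% h₂]; simp [← comp_whiskerRight]⟩
  hom_inv_id := by ext; simp
  inv_hom_id := by ext; simp

variable (B) in
/-- Crossed modules over `B` are closed under the tensor product with the diagonal action and
coaction, and the unit object with action `ε` and coaction `η` is a crossed module. -/
class TensorClosed : Prop where
  unit : IsCrossedModule B ((λ_ B).hom ≫ ε) (η ≫ (λ_ B).inv)
  tensor (V W : CrossedModule B) :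
    IsCrossedModule B (diagRightAct V.act W.act) (diagRightCoact V.coact W.coact)

section Monoidal

variable [TensorClosed B]

variable (B) in
/-- The unit object `(𝟙, ε, η)`. -/
@[simps]
abbrev unit : CrossedModule B where
  X := 𝟙_ C
  act := (λ_ B).hom ≫ ε
  coact := η ≫ (λ_ B).inv
  isCrossedModule := TensorClosed.unit

/-- The tensor product of crossed modules, with diagonal action and coaction. -/
@[simps]
abbrev tensor (V W : CrossedModule B) : CrossedModule B where
  X := V.X ⊗ W.X
  act := diagRightAct V.act W.act
  coact := diagRightCoact V.coact W.coact
  isCrossedModule := TensorClosed.tensor V W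

/-- The tensor product of morphisms is that of `C`. -/
@[simps]
def tensorMap {V V' W W' : CrossedModule B} (f : V ⟶ V') (g : W ⟶ W') :
    tensor V W ⟶ tensor V' W' where
  hom := f.hom ⊗ₘ g.hom
  act_hom := diagRightAct_natural f.act_hom g.act_hom
  coact_hom := diagRightCoact_natural f.coact_hom g.coact_hom

/-- The monoidal structure on crossed modules: unit, tensor product and coherence isomorphisms are
those of `C`. -/
instance : MonoidalCategoryStruct (CrossedModule B) where
  tensorObj := tensor
  whiskerLeft V _ _ f := tensorMap (𝟙 V) f
  whiskerRight f W := tensorMap f (𝟙 W)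
  tensorHom := tensorMap
  tensorUnit := unit B
  associator U V W := isoMk (α_ U.X V.X W.X) (diagRightAct_assoc _ _ _) (diagRightCoact_assoc _ _ _)
  leftUnitor V := isoMk (λ_ V.X) (diagRightAct_lambda _) (diagRightCoact_lambda _)
  rightUnitor V := isoMk (ρ_ V.X) (diagRightAct_rho _) (diagRightCoact_rho _)

@[simp] lemma tensorHom_hom {V V' W W' : CrossedModule B} (f : V ⟶ V') (g : W ⟶ W') :
    (f ⊗ₘ g).hom = f.hom ⊗ₘ g.hom := rfl
@[simp] lemma whiskerLeft_hom (V : CrossedModule B) {W W' : CrossedModule B} (g : W ⟶ W') :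
    (V ◁ g).hom = V.X ◁ g.hom := id_tensorHom _ _
@[simp] lemma whiskerRight_hom {V V' : CrossedModule B} (f : V ⟶ V') (W : CrossedModule B) :
    (f ▷ W).hom = f.hom ▷ W.X := tensorHom_id _ _
@[simp] lemma associator_hom_hom (U V W : CrossedModule B) :
    (α_ U V W).hom.hom = (α_ U.X V.X W.X).hom := rfl
@[simp] lemma leftUnitor_hom_hom (V : CrossedModule B) :
    (λ_ V).hom.hom = (λ_ V.X).hom := rfl
@[simp] lemma rightUnitor_hom_hom (V : CrossedModule B) :
    (ρ_ V).hom.hom = (ρ_ V.X).hom := rfl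
@[simp] lemma tensorObj_X (V W : CrossedModule B) : (V ⊗ W).X = V.X ⊗ W.X := rfl
@[simp] lemma tensorUnit_X : (𝟙_ (CrossedModule B)).X = 𝟙_ C := rfl

/-- The monoidal category of crossed modules. -/
instance : MonoidalCategory (CrossedModule B) where
  tensorHom_def f g := by ext; simp [MonoidalCategory.tensorHom_def]
  id_tensorHom_id V W := by ext; exact id_tensorHom_id _ _
  tensorHom_comp_tensorHom f g f' g' := by ext; simp
  whiskerLeft_id V W := by ext; simp
  id_whiskerRight V W := by ext; simp
  associator_naturality f g h := by ext; simp
  leftUnitor_naturality f := by ext; simp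
  rightUnitor_naturality f := by ext; simp
  pentagon U V W X := by ext; simp
  triangle V W := by ext; simp

end Monoidal

/-- The morphism `(id_W ⊗ act_V) ∘ (Ψ_{V,W} ⊗ id_B) ∘ (id_V ⊗ coact_W) : V ⊗ W ⟶ W ⊗ V`. -/
def braidHom (V W : CrossedModule B) : V.X ⊗ W.X ⟶ W.X ⊗ V.X :=
  V.X ◁ W.coact ≫ (α_ V.X W.X B).inv ≫ (β_ V.X W.X).hom ▷ B ≫ (α_ W.X V.X B).hom ≫ W.X ◁ V.act

end CrossedModule

/-! ### Hopf bimodules -/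

/-- The axioms of a Hopf bimodule over a bialgebra: a bimodule and a bicomodule whose coactions
are bimodule morphisms, where the bialgebra carries its regular actions and tensor products carry
the diagonal actions. -/
structure IsHopfBimodule (B : C) [BimonObj B] {X : C} (lact : B ⊗ X ⟶ X) (ract : X ⊗ B ⟶ X)
    (lcoact : X ⟶ B ⊗ X) (rcoact : X ⟶ X ⊗ B) : Prop where
  isLeftModule : IsLeftModule B lact
  isRightModule : IsRightModule B ract
  lact_ract : lact ▷ B ≫ ract = (α_ B X B).hom ≫ B ◁ ract ≫ lact
  isLeftComodule : IsLeftComodule B lcoact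
  isRightComodule : IsRightComodule B rcoact
  lcoact_rcoact : lcoact ≫ B ◁ rcoact = rcoact ≫ lcoact ▷ B ≫ (α_ B X B).hom
  lact_lcoact : lact ≫ lcoact = (Δ ⊗ₘ lcoact) ≫ tensorμ B B B X ≫ (μ ⊗ₘ lact)
  ract_lcoact : ract ≫ lcoact = (lcoact ⊗ₘ Δ) ≫ tensorμ B X B B ≫ (μ ⊗ₘ ract)
  lact_rcoact : lact ≫ rcoact = (Δ ⊗ₘ rcoact) ≫ tensorμ B B X B ≫ (lact ⊗ₘ μ)
  ract_rcoact : ract ≫ rcoact = (rcoact ⊗ₘ Δ) ≫ tensorμ X B B B ≫ (ract ⊗ₘ μ)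

/-- Hopf bimodules over the bialgebra `B`. -/
structure HopfBimodule (B : C) [BimonObj B] where
  /-- The underlying object. -/
  X : C
  /-- The left action. -/
  lact : B ⊗ X ⟶ X
  /-- The right action. -/
  ract : X ⊗ B ⟶ X
  /-- The left coaction. -/
  lcoact : X ⟶ B ⊗ X
  /-- The right coaction. -/
  rcoact : X ⟶ X ⊗ B
  isHopfBimodule : IsHopfBimodule B lact ract lcoact rcoact

namespace HopfBimodule

section Bialgebra

variable {B : C} [BimonObj B]

/-- Morphisms of Hopf bimodules are the bimodule and bicomodule morphisms. -/
@[ext]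
structure Hom (M N : HopfBimodule B) where
  /-- The underlying morphism. -/
  hom : M.X ⟶ N.X
  lact_hom : M.lact ≫ hom = B ◁ hom ≫ N.lact
  ract_hom : M.ract ≫ hom = hom ▷ B ≫ N.ract
  lcoact_hom : M.lcoact ≫ B ◁ hom = hom ≫ N.lcoact
  rcoact_hom : M.rcoact ≫ hom ▷ B = hom ≫ N.rcoact

instance : Category (HopfBimodule B) where
  Hom M N := Hom M N
  id M := ⟨𝟙 M.X, by simp, by simp, by simp, by simp⟩
  comp f g := ⟨f.hom ≫ g.hom,
    by rw [reassoc_of% f.lact_hom, g.lact_hom]; simp,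
    by rw [reassoc_of% f.ract_hom, g.ract_hom]; simp,
    by rw [MonoidalCategory.whiskerLeft_comp, reassoc_of% f.lcoact_hom, g.lcoact_hom]; simp,
    by rw [comp_whiskerRight, reassoc_of% f.rcoact_hom, g.rcoact_hom]; simp⟩

@[ext]
lemma hom_ext {M N : HopfBimodule B} {f g : M ⟶ N} (h : f.hom = g.hom) : f = g :=
  Hom.ext h

@[simp] lemma id_hom (M : HopfBimodule B) : Hom.hom (𝟙 M) = 𝟙 M.X := rfl

@[simp] lemma comp_hom {L M N : HopfBimodule B} (f : L ⟶ M) (g : M ⟶ N) :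
    (f ≫ g).hom = f.hom ≫ g.hom := rfl

/-- An isomorphism of underlying objects that is a morphism of Hopf bimodules is an isomorphism
of Hopf bimodules. -/
@[simps]
def isoMk {M N : HopfBimodule B} (f : M.X ≅ N.X) (h₁ : M.lact ≫ f.hom = B ◁ f.hom ≫ N.lact)
    (h₂ : M.ract ≫ f.hom = f.hom ▷ B ≫ N.ract)
    (h₃ : M.lcoact ≫ B ◁ f.hom = f.hom ≫ N.lcoact)
    (h₄ : M.rcoact ≫ f.hom ▷ B = f.hom ≫ N.rcoact) : M ≅ N where
  hom := ⟨f.hom, h₁, h₂, h₃, h₄⟩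
  inv := ⟨f.inv,
    by rw [Iso.comp_inv_eq, Category.assoc, h₁]; simp [← MonoidalCategory.whiskerLeft_comp_assoc],
    by rw [Iso.comp_inv_eq, Category.assoc, h₂]; simp [← comp_whiskerRight_assoc],
    by rw [Iso.eq_inv_comp, ← reassoc_of% h₃]; simp [← MonoidalCategory.whiskerLeft_comp],
    by rw [Iso.eq_inv_comp, ← reassoc_of% h₄]; simp [← comp_whiskerRight]⟩
  hom_inv_id := by ext; simp
  inv_hom_id := by ext; simp

variable (B) in
/-- The regular Hopf bimodule: `B` with multiplication and comultiplication on both sides. -/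
@[simps]
abbrev regular : HopfBimodule B where
  X := B
  lact := μ
  ract := μ
  lcoact := Δ
  rcoact := Δ
  isHopfBimodule :=
    { isLeftModule := ⟨by simp, by simp⟩
      isRightModule := ⟨by simp, by simp⟩
      lact_ract := by simp
      isLeftComodule := ⟨by simp, by simp⟩
      isRightComodule := ⟨by simp, by simp⟩
      lcoact_rcoact := by simp
      lact_lcoact := by simp
      ract_lcoact := by simp
      lact_rcoact := by simp
      ract_rcoact := by simp }

variable (B) in
/-- The tensor product `M ⊗ V` of a Hopf bimodule `M` and a crossed module `V` is a Hopf bimodule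
with the left action and left coaction induced by `M`, and the diagonal right action and right
coaction. -/
class TensorCrossedClosed : Prop where
  tensorCrossed (M : HopfBimodule B) (V : CrossedModule B) :
    IsHopfBimodule B (inducedLeftAct M.lact V.X) (diagRightAct M.ract V.act)
      (inducedLeftCoact M.lcoact V.X) (diagRightCoact M.rcoact V.coact)

section

variable [TensorCrossedClosed B]

/-- The Hopf bimodule `M ⊗ V`, for a Hopf bimodule `M` and a crossed module `V`. -/
@[simps]
abbrev tensorCrossed (M : HopfBimodule B) (V : CrossedModule B) : HopfBimodule B where
  X := M.X ⊗ V.X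
  lact := inducedLeftAct M.lact V.X
  ract := diagRightAct M.ract V.act
  lcoact := inducedLeftCoact M.lcoact V.X
  rcoact := diagRightCoact M.rcoact V.coact
  isHopfBimodule := TensorCrossedClosed.tensorCrossed M V

/-- The tensor product of a morphism of Hopf bimodules and a morphism of crossed modules. -/
@[simps]
def tensorCrossedMap {M M' : HopfBimodule B} {V V' : CrossedModule B} (f : M ⟶ M') (g : V ⟶ V') :
    tensorCrossed M V ⟶ tensorCrossed M' V' where
  hom := f.hom ⊗ₘ g.hom
  lact_hom := inducedLeftAct_natural g.hom f.lact_hom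
  ract_hom := diagRightAct_natural f.ract_hom g.act_hom
  lcoact_hom := inducedLeftCoact_natural g.hom f.lcoact_hom
  rcoact_hom := diagRightCoact_natural f.rcoact_hom g.coact_hom

variable (B) in
/-- The functor `B ⋉ (-)`, sending a crossed module `V` to the Hopf bimodule `B ⊗ V` with induced
left and diagonal right actions and coactions, and a morphism `f` to `id_B ⊗ f`. -/
@[simps]
def smash : CrossedModule B ⥤ HopfBimodule B where
  obj V := tensorCrossed (regular B) V
  map f := tensorCrossedMap (𝟙 (regular B)) f
  map_id V := by
    ext
    exact id_tensorHom_id _ _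
  map_comp f g := by
    ext
    simp only [tensorCrossedMap_hom, comp_hom, CrossedModule.comp_hom, id_hom, id_tensorHom]
    exact MonoidalCategory.whiskerLeft_comp _ _ _

/-- `(M ⊗ V) ⊗ W ≅ M ⊗ (V ⊗ W)` for a Hopf bimodule `M` and crossed modules `V`, `W`. -/
def tensorCrossedAssoc [CrossedModule.TensorClosed B] (M : HopfBimodule B)
    (V W : CrossedModule B) :
    tensorCrossed (tensorCrossed M V) W ≅ tensorCrossed M (V ⊗ W) :=
  isoMk (α_ M.X V.X W.X) (inducedLeftAct_assoc _ _ _) (diagRightAct_assoc _ _ _)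
    (inducedLeftCoact_assoc _ _ _) (diagRightCoact_assoc _ _ _)

/-- `M ⊗ 𝟙 ≅ M` for a Hopf bimodule `M`. -/
def tensorCrossedUnit [CrossedModule.TensorClosed B] (M : HopfBimodule B) :
    tensorCrossed M (𝟙_ (CrossedModule B)) ≅ M :=
  isoMk (ρ_ M.X) (inducedLeftAct_rho _) (diagRightAct_rho _) (inducedLeftCoact_rho _) (diagRightCoact_rho _)

end

end Bialgebra


section Hopf

variable {H : C} [HopfObj H]

/-- The endomorphism `Π = lact ∘ (S ⊗ id) ∘ lcoact` of (the object underlying) a Hopf bimodule. -/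
def proj (M : HopfBimodule H) : M.X ⟶ M.X :=
  M.lcoact ≫ 𝒮 ▷ M.X ≫ M.lact

lemma proj_natural {M N : HopfBimodule H} (f : M ⟶ N) : proj M ≫ f.hom = f.hom ≫ proj N := by
  simp only [proj, Category.assoc, f.lact_hom, ← reassoc_of% f.lcoact_hom, whisker_exchange_assoc]

lemma proj_regular : proj (regular H) = ε[H] ≫ η[H] :=
  HopfObj.antipode_left H

lemma proj_tensorCrossed [TensorCrossedClosed H] (M : HopfBimodule H) (V : CrossedModule H) :
    proj (tensorCrossed M V) = proj M ▷ V.X := by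
  change (M.lcoact ▷ V.X ≫ (α_ H M.X V.X).hom) ≫ 𝒮 ▷ (M.X ⊗ V.X) ≫
    (α_ H M.X V.X).inv ≫ M.lact ▷ V.X = _
  simp [proj]

end Hopf

variable (H : C) [HopfObj H]

/-- A choice, for every Hopf bimodule `M`, of a splitting `incl : inv M ⟶ M`,
`retr : M ⟶ inv M` of `Π : M ⟶ M`. -/
class InvariantSplitting where
  /-- The object of invariants. -/
  inv : HopfBimodule H → C
  /-- The inclusion of the invariants. -/
  incl (M : HopfBimodule H) : inv M ⟶ M.X
  /-- The projection onto the invariants. -/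
  retr (M : HopfBimodule H) : M.X ⟶ inv M
  incl_retr (M : HopfBimodule H) : incl M ≫ retr M = 𝟙 (inv M)
  retr_incl (M : HopfBimodule H) : retr M ≫ incl M = proj M

variable {H}
open InvariantSplitting

attribute [simp] incl_retr retr_incl

section Invariants

variable [InvariantSplitting H]

@[simp]
lemma incl_proj (M : HopfBimodule H) : incl M ≫ proj M = incl M := by
  rw [← retr_incl, reassoc_of% incl_retr]

@[simp]
lemma proj_retr (M : HopfBimodule H) : proj M ≫ retr M = retr M := by
  rw [← retr_incl, Category.assoc, incl_retr, Category.comp_id]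

/-- The right action `retr ∘ ract ∘ (incl ⊗ id)` on the invariants. -/
def invAct (M : HopfBimodule H) : inv M ⊗ H ⟶ inv M :=
  incl M ▷ H ≫ M.ract ≫ retr M

/-- The right coaction `(retr ⊗ id) ∘ rcoact ∘ incl` on the invariants. -/
def invCoact (M : HopfBimodule H) : inv M ⟶ inv M ⊗ H :=
  incl M ≫ M.rcoact ≫ retr M ▷ H

/-- The morphism induced on invariants by a morphism of Hopf bimodules. -/
def invMap {M N : HopfBimodule H} (f : M ⟶ N) : inv M ⟶ inv N :=
  incl M ≫ f.hom ≫ retr N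

@[simp]
lemma invMap_incl {M N : HopfBimodule H} (f : M ⟶ N) : invMap f ≫ incl N = incl M ≫ f.hom := by
  rw [invMap, Category.assoc, Category.assoc, retr_incl, ← proj_natural, reassoc_of% incl_proj]

@[simp]
lemma retr_invMap {M N : HopfBimodule H} (f : M ⟶ N) : retr M ≫ invMap f = f.hom ≫ retr N := by
  rw [invMap, reassoc_of% retr_incl, reassoc_of% proj_natural f, proj_retr]

variable (H) in
/-- The invariants of every Hopf bimodule form a crossed module. -/
class InvariantsCrossed : Prop where
  isCrossedModule (M : HopfBimodule H) : IsCrossedModule H (invAct M) (invCoact M)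

variable [InvariantsCrossed H]

/-- The crossed module of invariants of a Hopf bimodule. -/
@[simps]
abbrev invObj (M : HopfBimodule H) : CrossedModule H where
  X := inv M
  act := invAct M
  coact := invCoact M
  isCrossedModule := InvariantsCrossed.isCrossedModule M

/-- The morphism of crossed modules `retr ∘ f ∘ incl` induced by a morphism `f`. -/
@[simps]
def invObjMap {M N : HopfBimodule H} (f : M ⟶ N) : invObj M ⟶ invObj N where
  hom := invMap f
  act_hom := by
    simp only [invObj, invAct, Category.assoc, retr_invMap, reassoc_of% f.ract_hom,
      ← comp_whiskerRight_assoc, invMap_incl]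
  coact_hom := by
    simp only [invObj, invCoact, Category.assoc, ← comp_whiskerRight, retr_invMap,
      reassoc_of% invMap_incl]
    simp only [comp_whiskerRight, reassoc_of% f.rcoact_hom]

lemma invObjMap_id (M : HopfBimodule H) : invObjMap (𝟙 M) = 𝟙 (invObj M) := by
  ext
  exact (congrArg (incl M ≫ ·) (Category.id_comp _)).trans (incl_retr M)

lemma invObjMap_comp {L M N : HopfBimodule H} (f : L ⟶ M) (g : M ⟶ N) :
    invObjMap f ≫ invObjMap g = invObjMap (f ≫ g) := by
  ext
  change invMap f ≫ invMap g = invMap (f ≫ g)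
  rw [invMap, Category.assoc, Category.assoc, retr_invMap, invMap, comp_hom, Category.assoc]

variable (H) in
/-- The functor of invariants, sending `f : M ⟶ N` to `retr ∘ f ∘ incl`. -/
@[simps]
def invariants : HopfBimodule H ⥤ CrossedModule H where
  obj := invObj
  map := invObjMap
  map_id := invObjMap_id
  map_comp f g := (invObjMap_comp f g).symm

section Monoidal

variable [TensorCrossedClosed H] [CrossedModule.TensorClosed H]

/-- The canonical isomorphism `incl ⊗ id` followed by `retr`, from `inv M ⊗ V` to
`inv (M ⊗ V)`. -/
def invTensorIso (M : HopfBimodule H) (V : CrossedModule H) :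
    invObj M ⊗ V ≅ invObj (tensorCrossed M V) :=
  have h : retr (tensorCrossed M V) ≫ incl (tensorCrossed M V) = (retr M ≫ incl M) ▷ V.X := by
    rw [retr_incl, proj_tensorCrossed, ← retr_incl]
  CrossedModule.isoMk
    { hom := incl M ▷ V.X ≫ retr (tensorCrossed M V)
      inv := incl (tensorCrossed M V) ≫ retr M ▷ V.X
      hom_inv_id := split_hom_inv (incl_retr M) h
      inv_hom_id := split_inv_hom (incl_retr (tensorCrossed M V)) h }
    (split_act M.ract V.act (incl_retr M) (incl_retr (tensorCrossed M V)) h)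
    (split_coact M.rcoact V.coact (incl_retr M) (incl_retr (tensorCrossed M V)) h)

lemma incl_regular : incl (regular H) ≫ ε[H] ≫ η[H] = incl (regular H) := by
  rw [← proj_regular]
  exact incl_proj (regular H)

lemma one_retr_incl_regular : η[H] ≫ retr (regular H) ≫ incl (regular H) = η[H] := by
  rw [retr_incl, proj_regular, BimonObj.one_counit_assoc]

/-- The canonical isomorphism `ε ∘ incl` from the invariants of `H` to the unit object. -/
def invRegularIso : invObj (regular H) ≅ 𝟙_ (CrossedModule H) :=
  CrossedModule.isoMk
    { hom := incl (regular H) ≫ ε[H]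
      inv := η[H] ≫ retr (regular H)
      hom_inv_id := by
        rw [Category.assoc, reassoc_of% incl_regular (H := H)]
        exact incl_retr (regular H)
      inv_hom_id := by
        rw [Category.assoc, reassoc_of% one_retr_incl_regular (H := H)]
        exact BimonObj.one_counit H }
    (by
      have h : retr (regular H) ≫ incl (regular H) ≫ ε[H] = ε[H] := by
        rw [reassoc_of% retr_incl, proj_regular, Category.assoc, BimonObj.one_counit, Category.comp_id]
      change (incl (regular H) ▷ H ≫ μ[H] ≫ retr (regular H)) ≫ incl (regular H) ≫ ε[H] =
        (incl (regular H) ≫ ε[H]) ▷ H ≫ (λ_ H).hom ≫ ε[H]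
      rw [Category.assoc, Category.assoc, h, BimonObj.mul_counit, comp_whiskerRight]
      simp [MonoidalCategory.tensorHom_def])
    (by
      have h : retr (regular H) ≫ incl (regular H) ≫ ε[H] = ε[H] := by
        rw [reassoc_of% retr_incl, proj_regular, Category.assoc, BimonObj.one_counit, Category.comp_id]
      change (incl (regular H) ≫ Δ[H] ≫ retr (regular H) ▷ H) ≫ (incl (regular H) ≫ ε[H]) ▷ H =
        (incl (regular H) ≫ ε[H]) ≫ η[H] ≫ (λ_ H).inv
      rw [Category.assoc, Category.assoc, Category.assoc, ← comp_whiskerRight, h,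
        ComonObj.counit_comul, reassoc_of% incl_regular (H := H)])

variable (H) in
/-- For every Hopf bimodule `M` the morphism `lact ∘ (id ⊗ incl) : H ⊗ inv M ⟶ M` is an isomorphism
of Hopf bimodules. -/
class InvariantsGenerate : Prop where
  exists_iso (M : HopfBimodule H) :
    ∃ e : tensorCrossed (regular H) (invObj M) ≅ M, e.hom.hom = H ◁ incl M ≫ M.lact

/-- The isomorphism `lact ∘ (id ⊗ incl) : H ⊗ inv M ≅ M`. -/
def regularTensorIso [InvariantsGenerate H] (M : HopfBimodule H) :
    tensorCrossed (regular H) (invObj M) ≅ M :=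
  (InvariantsGenerate.exists_iso M).choose

lemma regularTensorIso_hom_hom [InvariantsGenerate H] (M : HopfBimodule H) :
    (regularTensorIso M).hom.hom = H ◁ incl M ≫ M.lact :=
  (InvariantsGenerate.exists_iso M).choose_spec

/-! Naturality and coherence of the isomorphisms above. -/

lemma tensorCrossedAssoc_natural {M M' : HopfBimodule H} {V V' W W' : CrossedModule H}
    (f : M ⟶ M') (g : V ⟶ V') (h : W ⟶ W') :
    tensorCrossedMap (tensorCrossedMap f g) h ≫ (tensorCrossedAssoc M' V' W').hom =
      (tensorCrossedAssoc M V W).hom ≫ tensorCrossedMap f (g ⊗ₘ h) := by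
  ext
  exact associator_naturality f.hom g.hom h.hom

lemma tensorCrossedUnit_natural {M M' : HopfBimodule H} (f : M ⟶ M') :
    tensorCrossedMap f (𝟙 (𝟙_ (CrossedModule H))) ≫ (tensorCrossedUnit M').hom =
      (tensorCrossedUnit M).hom ≫ f := by
  ext
  exact (congrArg (· ≫ _) (tensorHom_id f.hom (𝟙_ C))).trans (rightUnitor_naturality f.hom)

lemma tensorCrossed_pentagon (M : HopfBimodule H) (U V W : CrossedModule H) :
    tensorCrossedMap (tensorCrossedAssoc M U V).hom (𝟙 W) ≫
        (tensorCrossedAssoc M (U ⊗ V) W).hom ≫ tensorCrossedMap (𝟙 M) (α_ U V W).hom =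
      (tensorCrossedAssoc (tensorCrossed M U) V W).hom ≫ (tensorCrossedAssoc M U (V ⊗ W)).hom := by
  ext
  have h := pentagon M.X U.X V.X W.X
  rw [← id_tensorHom, ← tensorHom_id] at h
  exact h

lemma tensorCrossed_triangle (M : HopfBimodule H) (V : CrossedModule H) :
    (tensorCrossedAssoc M (𝟙_ (CrossedModule H)) V).hom ≫ tensorCrossedMap (𝟙 M) (λ_ V).hom =
      tensorCrossedMap (tensorCrossedUnit M).hom (𝟙 V) := by
  ext
  have h := triangle M.X V.X
  rw [← id_tensorHom, ← tensorHom_id] at h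
  exact h

lemma invTensorIso_natural {M M' : HopfBimodule H} {V V' : CrossedModule H} (f : M ⟶ M')
    (g : V ⟶ V') :
    (invObjMap f ⊗ₘ g) ≫ (invTensorIso M' V').hom =
      (invTensorIso M V).hom ≫ invObjMap (tensorCrossedMap f g) := by
  ext
  have h := retr_invMap (tensorCrossedMap f g)
  change (invMap f ⊗ₘ g.hom) ≫ incl M' ▷ V'.X ≫ retr (tensorCrossed M' V') =
    (incl M ▷ V.X ≫ retr (tensorCrossed M V)) ≫ invMap (tensorCrossedMap f g)
  rw [Category.assoc, h, ← tensorHom_id, ← tensorHom_id, tensorHom_comp_tensorHom_assoc,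
    tensorCrossedMap_hom, tensorHom_comp_tensorHom_assoc, invMap_incl, Category.id_comp,
    Category.comp_id]

lemma invTensorIso_assoc (M : HopfBimodule H) (V W : CrossedModule H) :
    ((invTensorIso M V).hom ⊗ₘ 𝟙 W) ≫ (invTensorIso (tensorCrossed M V) W).hom ≫
        invObjMap (tensorCrossedAssoc M V W).hom =
      (α_ (invObj M) V W).hom ≫ (invTensorIso M (V ⊗ W)).hom := by
  ext
  have h := retr_invMap (tensorCrossedAssoc M V W).hom
  have h' : (incl M ▷ V.X ≫ proj (tensorCrossed M V)) = incl M ▷ V.X := by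
    rw [proj_tensorCrossed, ← comp_whiskerRight, incl_proj]
  change ((incl M ▷ V.X ≫ retr (tensorCrossed M V)) ⊗ₘ 𝟙 W.X) ≫
    (incl (tensorCrossed M V) ▷ W.X ≫ retr (tensorCrossed (tensorCrossed M V) W)) ≫
      invMap (tensorCrossedAssoc M V W).hom = (α_ (inv M) V.X W.X).hom ≫
        incl M ▷ (V.X ⊗ W.X) ≫ retr (tensorCrossed M (V ⊗ W))
  rw [Category.assoc, h, tensorHom_id, ← comp_whiskerRight_assoc, Category.assoc, retr_incl, h']
  exact associator_naturality_left_assoc _ _ _ _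

lemma invTensorIso_regular [InvariantsGenerate H] (M : HopfBimodule H) :
    (invTensorIso (regular H) (invObj M)).hom ≫ invObjMap (regularTensorIso M).hom =
      (invRegularIso.hom ⊗ₘ 𝟙 (invObj M)) ≫ (λ_ (invObj M)).hom := by
  ext
  have h := retr_invMap (regularTensorIso M).hom
  have h' : η[H] ▷ M.X ≫ M.lact = (λ_ M.X).hom := M.isHopfBimodule.isLeftModule.one_act
  change (incl (regular H) ▷ inv M ≫ retr (tensorCrossed (regular H) (invObj M))) ≫
    invMap (regularTensorIso M).hom = ((incl (regular H) ≫ ε[H]) ⊗ₘ 𝟙 (inv M)) ≫ (λ_ (inv M)).hom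
  rw [Category.assoc, h, regularTensorIso_hom_hom, ← incl_regular]
  simp only [comp_whiskerRight, Category.assoc, tensorHom_id]
  rw [← whisker_exchange_assoc, reassoc_of% h', leftUnitor_naturality_assoc, incl_retr,
    Category.comp_id, ← comp_whiskerRight_assoc η[H], BimonObj.one_counit, id_whiskerRight,
    Category.id_comp]

lemma regularTensorIso_natural [InvariantsGenerate H] {M N : HopfBimodule H} (f : M ⟶ N) :
    tensorCrossedMap (𝟙 (regular H)) (invObjMap f) ≫ (regularTensorIso N).hom =
      (regularTensorIso M).hom ≫ f := by
  ext
  have h := f.lact_hom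
  rw [comp_hom, comp_hom, regularTensorIso_hom_hom, regularTensorIso_hom_hom, Category.assoc, h]
  change (𝟙 H ⊗ₘ invMap f) ≫ _ = _
  rw [id_tensorHom, ← MonoidalCategory.whiskerLeft_comp_assoc,
    ← MonoidalCategory.whiskerLeft_comp_assoc, invMap_incl]

lemma tensorCrossedMap_id (M : HopfBimodule H) (V : CrossedModule H) :
    tensorCrossedMap (𝟙 M) (𝟙 V) = 𝟙 (tensorCrossed M V) := by
  ext
  exact id_tensorHom_id M.X V.X

lemma tensorCrossedMap_comp {L M N : HopfBimodule H} {U V W : CrossedModule H} (f : L ⟶ M)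
    (g : U ⟶ V) (f' : M ⟶ N) (g' : V ⟶ W) :
    tensorCrossedMap f g ≫ tensorCrossedMap f' g' = tensorCrossedMap (f ≫ f') (g ≫ g') := by
  ext
  exact tensorHom_comp_tensorHom f.hom g.hom f'.hom g'.hom

variable [InvariantsGenerate H]

/-- `M ⊗ V ≅ M ⊗ W` for isomorphic crossed modules `V` and `W`. -/
def tensorCrossedIso (M : HopfBimodule H) {V W : CrossedModule H} (e : V ≅ W) :
    tensorCrossed M V ≅ tensorCrossed M W where
  hom := tensorCrossedMap (𝟙 M) e.hom
  inv := tensorCrossedMap (𝟙 M) e.inv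
  hom_inv_id := by simp [tensorCrossedMap_comp, tensorCrossedMap_id]
  inv_hom_id := by simp [tensorCrossedMap_comp, tensorCrossedMap_id]

/-- The tensor product `M ⊗ inv N` of Hopf bimodules, with unit object `H` and the
canonical coherence isomorphisms. -/
instance : MonoidalCategoryStruct (HopfBimodule H) where
  tensorObj M N := tensorCrossed M (invObj N)
  whiskerLeft M _ _ g := tensorCrossedMap (𝟙 M) (invObjMap g)
  whiskerRight f N := tensorCrossedMap f (𝟙 (invObj N))
  tensorHom f g := tensorCrossedMap f (invObjMap g)
  tensorUnit := regular H
  associator L M N := tensorCrossedAssoc L (invObj M) (invObj N) ≪≫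
    tensorCrossedIso L (invTensorIso M (invObj N))
  leftUnitor M := regularTensorIso M
  rightUnitor M := tensorCrossedIso M invRegularIso ≪≫ tensorCrossedUnit M

/-- The monoidal category of Hopf bimodules. -/
instance : MonoidalCategory (HopfBimodule H) where
  tensorHom_def {M M' N N'} f g := by
    have h := tensorCrossedMap_comp f (𝟙 (invObj N)) (𝟙 _) (invObjMap g)
    rw [Category.comp_id, Category.id_comp] at h
    exact h.symm
  id_tensorHom_id M N := by
    have h := tensorCrossedMap_id M (invObj N)
    rw [← invObjMap_id N] at h
    exact h
  tensorHom_comp_tensorHom f g f' g' := by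
    have h := tensorCrossedMap_comp f (invObjMap g) f' (invObjMap g')
    rw [invObjMap_comp] at h
    exact h
  whiskerLeft_id M N := by
    have h := tensorCrossedMap_id M (invObj N)
    rw [← invObjMap_id N] at h
    exact h
  id_whiskerRight M N := tensorCrossedMap_id M (invObj N)
  associator_naturality {L M N L' M' N'} f g h := by
    change tensorCrossedMap (tensorCrossedMap f (invObjMap g)) (invObjMap h) ≫
      (tensorCrossedAssoc L' (invObj M') (invObj N')).hom ≫
        tensorCrossedMap (𝟙 L') (invTensorIso M' (invObj N')).hom =
      ((tensorCrossedAssoc L (invObj M) (invObj N)).hom ≫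
        tensorCrossedMap (𝟙 L) (invTensorIso M (invObj N)).hom) ≫
          tensorCrossedMap f (invObjMap (tensorCrossedMap g (invObjMap h)))
    rw [reassoc_of% tensorCrossedAssoc_natural, tensorCrossedMap_comp, Category.assoc,
      tensorCrossedMap_comp, invTensorIso_natural, Category.id_comp, Category.comp_id]
  leftUnitor_naturality f := regularTensorIso_natural f
  rightUnitor_naturality {M N} f := by
    change tensorCrossedMap f (𝟙 (invObj (regular H))) ≫
      tensorCrossedMap (𝟙 N) invRegularIso.hom ≫ (tensorCrossedUnit N).hom =
      (tensorCrossedMap (𝟙 M) invRegularIso.hom ≫ (tensorCrossedUnit M).hom) ≫ f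
    rw [Category.assoc, ← tensorCrossedUnit_natural, reassoc_of% tensorCrossedMap_comp,
      reassoc_of% tensorCrossedMap_comp]
    simp only [Category.id_comp, Category.comp_id]
  pentagon K L M N := by
    have h := tensorCrossed_pentagon K (invObj L) (invObj M) (invObj N)
    have hu := invTensorIso_assoc L (invObj M) (invObj N)
    have hn := invTensorIso_natural (𝟙 L) (invTensorIso M (invObj N)).hom
    rw [invObjMap_id] at hn
    change tensorCrossedMap ((tensorCrossedAssoc K (invObj L) (invObj M)).hom ≫
        tensorCrossedMap (𝟙 K) (invTensorIso L (invObj M)).hom) (𝟙 (invObj N)) ≫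
      ((tensorCrossedAssoc K (invObj (tensorCrossed L (invObj M))) (invObj N)).hom ≫
        tensorCrossedMap (𝟙 K) (invTensorIso (tensorCrossed L (invObj M)) (invObj N)).hom) ≫
      tensorCrossedMap (𝟙 K) (invObjMap ((tensorCrossedAssoc L (invObj M) (invObj N)).hom ≫
        tensorCrossedMap (𝟙 L) (invTensorIso M (invObj N)).hom)) =
      ((tensorCrossedAssoc (tensorCrossed K (invObj L)) (invObj M) (invObj N)).hom ≫
        tensorCrossedMap (𝟙 _) (invTensorIso M (invObj N)).hom) ≫
      (tensorCrossedAssoc K (invObj L) (invObj (tensorCrossed M (invObj N)))).hom ≫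
        tensorCrossedMap (𝟙 K) (invTensorIso L (invObj (tensorCrossed M (invObj N)))).hom
    rw [← invObjMap_comp]
    have e1 : tensorCrossedMap ((tensorCrossedAssoc K (invObj L) (invObj M)).hom ≫
        tensorCrossedMap (𝟙 K) (invTensorIso L (invObj M)).hom) (𝟙 (invObj N)) =
      tensorCrossedMap (tensorCrossedAssoc K (invObj L) (invObj M)).hom (𝟙 (invObj N)) ≫
        tensorCrossedMap (tensorCrossedMap (𝟙 K) (invTensorIso L (invObj M)).hom)
          (𝟙 (invObj N)) := by
      rw [tensorCrossedMap_comp, Category.comp_id]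
    rw [e1, ← tensorCrossedMap_id K, Category.assoc, Category.assoc, Category.assoc,
      reassoc_of% tensorCrossedAssoc_natural, tensorCrossedMap_comp, tensorCrossedMap_comp,
      reassoc_of% hu, reassoc_of% tensorCrossedAssoc_natural, tensorCrossedMap_comp, ← hn,
      ← reassoc_of% h, tensorCrossedMap_comp]
  triangle M N := by
    have h := tensorCrossed_triangle M (invObj N)
    have hu := invTensorIso_regular N
    change ((tensorCrossedAssoc M (invObj (regular H)) (invObj N)).hom ≫
        tensorCrossedMap (𝟙 M) (invTensorIso (regular H) (invObj N)).hom) ≫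
      tensorCrossedMap (𝟙 M) (invObjMap (regularTensorIso N).hom) =
      tensorCrossedMap (tensorCrossedMap (𝟙 M) invRegularIso.hom ≫ (tensorCrossedUnit M).hom)
        (𝟙 (invObj N))
    have e1 : tensorCrossedMap (tensorCrossedMap (𝟙 M) invRegularIso.hom ≫
        (tensorCrossedUnit M).hom) (𝟙 (invObj N)) =
        tensorCrossedMap (tensorCrossedMap (𝟙 M) invRegularIso.hom) (𝟙 (invObj N)) ≫
          tensorCrossedMap (tensorCrossedUnit M).hom (𝟙 (invObj N)) := by
      rw [tensorCrossedMap_comp, Category.comp_id]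
    rw [e1, ← h, reassoc_of% tensorCrossedAssoc_natural, tensorCrossedMap_comp, Category.assoc,
      tensorCrossedMap_comp, hu]

end Monoidal

/-- The morphism
`(lact_N ⊗ retr ∘ ract_M) ∘ (id ⊗ Ψ_{M,N} ⊗ id) ∘ (lcoact_M ⊗ rcoact_N ∘ incl)`
from `M ⊗ inv N` to `N ⊗ inv M`. -/
def braidHom (M N : HopfBimodule H) : M.X ⊗ inv N ⟶ N.X ⊗ inv M :=
  (M.lcoact ⊗ₘ (incl N ≫ N.rcoact)) ≫ tensorμ H M.X N.X H ≫ (N.lact ⊗ₘ (M.ract ≫ retr M))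

end Invariants

end HopfBimodule
end BraidedHopf
end

open BraidedHopf

/-!
The functor `H ⋉ (-)` has the functor of invariants as a quasi-inverse because a Hopf bimodule `M`
is freely generated by its invariants. The endomorphism `Π = lact ∘ (S ⊗ id) ∘ lcoact` is
idempotent (`HopfBimodule.proj_proj`), it turns the left action into the counit (`lact_proj`), its
image is coinvariant for the left coaction (`proj_lcoact`), and `lact ∘ (id ⊗ Π) ∘ lcoact = id`
(`lcoact_proj_lact`). Hence `lact ∘ (id ⊗ incl)` and `(id ⊗ retr) ∘ lcoact` are inverse
isomorphisms between `H ⊗ inv M` and `M` (`HopfBimodule.generateIso`). The same relations show that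
the right action and coaction induced on the image of `Π` form a crossed module
(`HopfBimodule.isCrossedModule_of_splitting`): both sides of the compatibility condition are equal
to `(retr ⊗ id) ∘ rcoact ∘ ract ∘ (incl ⊗ id)`.

That `M ⊗ V` is a Hopf bimodule is checked axiom by axiom; the compatibility condition of `V` is
needed only for the compatibility of the right action with the right coaction
(`tensorCrossed_ract_rcoact`). No separate verification is needed for tensor products of crossed
modules: `V ⊗ W` is the crossed module of invariants of the Hopf bimodule `(H ⊗ V) ⊗ W`, and the
unit object that of `H` (`CrossedModule.tensorClosed`).

For crossed modules the morphism `braidHom V W` is `(id ⊗ a) ∘ (coact_W ⊗ id) ∘ Ψ_{V,W}`, where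
`a : H ⊗ V ⟶ V` is the right action composed with an inverse braiding. As `S⁻¹` is an antipode for the
multiplication composed with the inverse braiding (`fork_inv_antipode_left`,
`fork_inv_antipode_right`), inserting `S⁻¹` in front of `a` gives the inverse of `braidHom V W`
(`CrossedModule.braidIso`).

The functor of invariants is a strong monoidal equivalence (`HopfBimodule.invariantsMonoidal`).
Along it the braiding of crossed modules is pulled back to Hopf bimodules, and `H ⋉ (-)` is braided
as a quasi-inverse of a braided functor (`inverse_braided`). The explicit formula for the braiding
of Hopf bimodules (`HopfBimodule.braiding_hom_hom`) follows from the naturality of the isomorphism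
`H ⊗ inv M ≅ M`.

Equations between string diagrams are proved by rewriting. A morphism `f` is replaced by the family
of its actions `f ▷ Z` on the first factors of right-nested tensor products, which determine it
(`Word.forall_whiskerRight`). The morphisms `Word.join`, `Word.fork`, `Word.cap`, `Word.cup` and
`Word.cross` absorb the associators and unitors, so that a diagram is a plain composite of left
whiskerings of these, and the exchange and naturality laws are rewriting rules for such composites.
-/

namespace BraidedHopf

universe v u

/-! ### Morphisms acting on the first factors of a right-nested tensor product -/

namespace Word

variable {C : Type u} [Category.{v} C] [MonoidalCategory C]

/-- A morphism `f : A ⊗ B ⟶ D` on the first two factors of `A ⊗ (B ⊗ Z)`. -/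
def join {A B D : C} (f : A ⊗ B ⟶ D) (Z : C) : A ⊗ (B ⊗ Z) ⟶ D ⊗ Z :=
  (α_ A B Z).inv ≫ f ▷ Z

/-- A morphism `f : D ⟶ A ⊗ B` on the first factor of `D ⊗ Z`, with right-nested target. -/
def fork {A B D : C} (f : D ⟶ A ⊗ B) (Z : C) : D ⊗ Z ⟶ A ⊗ (B ⊗ Z) :=
  f ▷ Z ≫ (α_ A B Z).hom

/-- A morphism `f : A ⟶ 𝟙` removing the first factor of `A ⊗ Z`. -/
def cap {A : C} (f : A ⟶ 𝟙_ C) (Z : C) : A ⊗ Z ⟶ Z :=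
  f ▷ Z ≫ (λ_ Z).hom

/-- A morphism `f : 𝟙 ⟶ A` inserting a new first factor in front of `Z`. -/
def cup {A : C} (f : 𝟙_ C ⟶ A) (Z : C) : Z ⟶ A ⊗ Z :=
  (λ_ Z).inv ≫ f ▷ Z

/-- The braiding of the first two factors of `X ⊗ (Y ⊗ Z)`. -/
def cross [BraidedCategory C] (X Y Z : C) : X ⊗ (Y ⊗ Z) ⟶ Y ⊗ (X ⊗ Z) :=
  (α_ X Y Z).inv ≫ (β_ X Y).hom ▷ Z ≫ (α_ Y X Z).hom

variable {A A' B D X Y Z Z' W T : C}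

section Whisker

/-! The lemma `whiskₘₙ` applies `W ◁ -` to an equation between a composite of `m` morphisms and a
composite of `n` morphisms, keeping both sides expanded. -/

variable {P Q R S P' Q' R' : C}

lemma whisk₂₀ (W : C) {f : P ⟶ Q} {g : Q ⟶ P} (e : f ≫ g = 𝟙 P) : W ◁ f ≫ W ◁ g = 𝟙 _ := by
  simp [← MonoidalCategory.whiskerLeft_comp, e]

lemma whisk₂₁ (W : C) {f : P ⟶ Q} {g : Q ⟶ R} {h : P ⟶ R} (e : f ≫ g = h) :
    W ◁ f ≫ W ◁ g = W ◁ h := by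
  simp [← MonoidalCategory.whiskerLeft_comp, e]

lemma whisk₂₂ (W : C) {f : P ⟶ Q} {g : Q ⟶ R} {h : P ⟶ Q'} {k : Q' ⟶ R} (e : f ≫ g = h ≫ k) :
    W ◁ f ≫ W ◁ g = W ◁ h ≫ W ◁ k := by
  simp only [← MonoidalCategory.whiskerLeft_comp, e]

lemma whisk₂₃ (W : C) {f : P ⟶ Q} {g : Q ⟶ S} {h : P ⟶ P'} {k : P' ⟶ Q'} {l : Q' ⟶ S}
    (e : f ≫ g = h ≫ k ≫ l) : W ◁ f ≫ W ◁ g = W ◁ h ≫ W ◁ k ≫ W ◁ l := by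
  simp only [← MonoidalCategory.whiskerLeft_comp, e]

lemma whisk₃₂ (W : C) {f : P ⟶ Q} {g : Q ⟶ R} {m : R ⟶ S} {h : P ⟶ P'} {k : P' ⟶ S}
    (e : f ≫ g ≫ m = h ≫ k) : W ◁ f ≫ W ◁ g ≫ W ◁ m = W ◁ h ≫ W ◁ k := by
  simp only [← MonoidalCategory.whiskerLeft_comp, e]

lemma whisk₃₃ (W : C) {f : P ⟶ Q} {g : Q ⟶ R} {m : R ⟶ S} {h : P ⟶ P'} {k : P' ⟶ Q'} {l : Q' ⟶ S}
    (e : f ≫ g ≫ m = h ≫ k ≫ l) :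
    W ◁ f ≫ W ◁ g ≫ W ◁ m = W ◁ h ≫ W ◁ k ≫ W ◁ l := by
  simp only [← MonoidalCategory.whiskerLeft_comp, e]

end Whisker

section Exchange

/-! The exchange laws: morphisms on disjoint factors commute. -/

lemma whiskerRight_exchange (f : A ⟶ A') (g : Z ⟶ Z') : f ▷ Z ≫ A' ◁ g = A ◁ g ≫ f ▷ Z' :=
  (whisker_exchange f g).symm

lemma join_exchange (f : A ⊗ B ⟶ D) (g : Z ⟶ Z') :
    join f Z ≫ D ◁ g = A ◁ B ◁ g ≫ join f Z' := by
  simp [join, whiskerRight_exchange]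

lemma fork_exchange (f : D ⟶ A ⊗ B) (g : Z ⟶ Z') :
    fork f Z ≫ A ◁ B ◁ g = D ◁ g ≫ fork f Z' := by
  simp [fork, ← reassoc_of% whiskerRight_exchange]

lemma cap_exchange (f : A ⟶ 𝟙_ C) (g : Z ⟶ Z') : cap f Z ≫ g = A ◁ g ≫ cap f Z' := by
  simp [cap, whisker_exchange_assoc]

lemma cup_exchange (f : 𝟙_ C ⟶ A) (g : Z ⟶ Z') : cup f Z ≫ A ◁ g = g ≫ cup f Z' := by
  simp [cup, whiskerRight_exchange]

variable [BraidedCategory C]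

lemma cross_exchange (g : Z ⟶ Z') :
    cross X Y Z ≫ Y ◁ X ◁ g = X ◁ Y ◁ g ≫ cross X Y Z' := by
  simp only [cross, Category.assoc, ← associator_naturality_right,
    reassoc_of% whiskerRight_exchange,
    associator_inv_naturality_right_assoc]

end Exchange

section Braid
variable [BraidedCategory C]

/-! Naturality of the braiding: in the lemmas named `_left` the morphism sits in the left argument
of the braiding, in the others in the right argument. -/

lemma cross_whiskerRight (f : A ⟶ A') :
    W ◁ f ▷ Z ≫ cross W A' Z = cross W A Z ≫ f ▷ (W ⊗ Z) := by
  have h := congrArg (fun t => (α_ _ _ _).inv ≫ t ▷ Z ≫ (α_ _ _ _).hom)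
    (braiding_naturality_right W f)
  refine Eq.trans ?_ (h.trans ?_) <;> simp only [cross] <;> monoidal

lemma cross_whiskerRight_left (f : A ⟶ A') :
    f ▷ (W ⊗ Z) ≫ cross A' W Z = cross A W Z ≫ W ◁ f ▷ Z := by
  have h := congrArg (fun t => (α_ _ _ _).inv ≫ t ▷ Z ≫ (α_ _ _ _).hom)
    (braiding_naturality_left f W)
  refine Eq.trans ?_ (h.trans ?_) <;> simp only [cross] <;> monoidal

lemma join_cross (f : A ⊗ B ⟶ D) :
    W ◁ join f Z ≫ cross W D Z =
      cross W A (B ⊗ Z) ≫ A ◁ cross W B Z ≫ join f (W ⊗ Z) := by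
  have h := congrArg (fun t => W ◁ (α_ _ _ _).inv ≫ (α_ _ _ _).inv ≫ t ▷ Z ≫ (α_ _ _ _).hom)
    (braiding_naturality_right W f)
  rw [braiding_tensor_right_hom] at h
  refine Eq.trans ?_ (h.trans ?_) <;> simp only [join, cross] <;> monoidal

lemma join_cross_left (f : A ⊗ B ⟶ D) :
    join f (W ⊗ Z) ≫ cross D W Z =
      A ◁ cross B W Z ≫ cross A W (B ⊗ Z) ≫ W ◁ join f Z := by
  have h := congrArg (fun t => (α_ _ _ _).inv ≫ (α_ _ _ _).inv ≫ t ▷ Z ≫ (α_ _ _ _).hom)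
    (braiding_naturality_left f W)
  rw [braiding_tensor_left_hom] at h
  refine Eq.trans ?_ (h.trans ?_) <;> simp only [join, cross] <;> monoidal

lemma fork_cross (f : D ⟶ A ⊗ B) :
    W ◁ fork f Z ≫ cross W A (B ⊗ Z) ≫ A ◁ cross W B Z =
      cross W D Z ≫ fork f (W ⊗ Z) := by
  have h := congrArg (fun t => (α_ _ _ _).inv ≫ t ▷ Z ≫ (α_ _ _ _).hom ≫ (α_ _ _ _).hom)
    (braiding_naturality_right W f)
  rw [braiding_tensor_right_hom] at h
  refine Eq.trans ?_ (h.trans ?_) <;> simp only [fork, cross] <;> monoidal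

lemma fork_cross_left (f : D ⟶ A ⊗ B) :
    fork f (W ⊗ Z) ≫ A ◁ cross B W Z ≫ cross A W (B ⊗ Z) =
      cross D W Z ≫ W ◁ fork f Z := by
  have h := congrArg (fun t => (α_ _ _ _).inv ≫ t ▷ Z ≫ (α_ _ _ _).hom ≫ W ◁ (α_ _ _ _).hom)
    (braiding_naturality_left f W)
  rw [braiding_tensor_left_hom] at h
  refine Eq.trans ?_ (h.trans ?_) <;> simp only [fork, cross] <;> monoidal

lemma cross_cap (f : A ⟶ 𝟙_ C) : cross W A Z ≫ cap f (W ⊗ Z) = W ◁ cap f Z := by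
  have h := congrArg (fun t => (α_ _ _ _).inv ≫ t ▷ Z ≫ (λ_ _).hom ▷ _)
    (braiding_naturality_right W f)
  rw [braiding_tensorUnit_right] at h
  refine Eq.trans ?_ (h.symm.trans ?_) <;> simp only [cap, cross] <;> monoidal

lemma cross_cap_left (f : A ⟶ 𝟙_ C) : cross A W Z ≫ W ◁ cap f Z = cap f (W ⊗ Z) := by
  have h := congrArg (fun t => (α_ _ _ _).inv ≫ t ▷ Z ≫ (ρ_ _).hom ▷ _)
    (braiding_naturality_left f W)
  rw [braiding_tensorUnit_left] at h
  refine Eq.trans ?_ (h.symm.trans ?_) <;> simp only [cap, cross] <;> monoidal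

lemma cup_cross (f : 𝟙_ C ⟶ A) : W ◁ cup f Z ≫ cross W A Z = cup f (W ⊗ Z) := by
  have h := congrArg (fun t => (ρ_ _).inv ▷ _ ≫ t ▷ Z ≫ (α_ _ _ _).hom)
    (braiding_naturality_right W f)
  rw [braiding_tensorUnit_right] at h
  refine Eq.trans ?_ (h.trans ?_) <;> simp only [cup, cross] <;> monoidal

/-- The Yang-Baxter equation. -/
lemma cross_cross :
    X ◁ cross Y W Z ≫ cross X W (Y ⊗ Z) ≫ W ◁ cross X Y Z =
      cross X Y (W ⊗ Z) ≫ Y ◁ cross X W Z ≫ cross Y W (X ⊗ Z) := by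
  have h := congrArg (fun t => X ◁ (α_ Y W Z).inv ≫ (α_ X (Y ⊗ W) Z).inv ≫ t ▷ Z ≫
    (α_ W (Y ⊗ X) Z).hom ≫ W ◁ (α_ Y X Z).hom) (yang_baxter X Y W)
  refine Eq.trans ?_ (h.symm.trans ?_) <;> simp only [cross] <;> monoidal

end Braid
end Word

/-! ### Identities between morphisms in terms of their action on first factors -/

variable {C : Type u} [Category.{v} C] [MonoidalCategory C]
namespace Word

/-- An equation may be checked after tensoring with an arbitrary object on the right. -/
lemma forall_whiskerRight {X Y : C} {f g : X ⟶ Y} : (∀ Z : C, f ▷ Z = g ▷ Z) ↔ f = g :=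
  ⟨fun h => (whiskerRight_iff f g).1 (h (𝟙_ C)), fun h _ => by rw [h]⟩

lemma join_join_right_iff {A X : C} {m : A ⊗ A ⟶ A} {a : X ⊗ A ⟶ X} :
    a ▷ A ≫ a = (α_ X A A).hom ≫ X ◁ m ≫ a ↔
      ∀ Z, join a (A ⊗ Z) ≫ join a Z = X ◁ join m Z ≫ join a Z := by
  rw [← forall_whiskerRight]
  refine forall_congr' fun Z => ?_
  rw [← cancel_epi ((α_ _ _ _).inv ≫ (α_ _ _ _).inv)]
  refine Eq.congr ?_ ?_ <;> (try simp only [join])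
  all_goals monoidal

lemma cup_join_right_iff {A X : C} {e : 𝟙_ C ⟶ A} {a : X ⊗ A ⟶ X} :
    X ◁ e ≫ a = (ρ_ X).hom ↔ ∀ Z, X ◁ cup e Z ≫ join a Z = 𝟙 _ := by
  rw [← forall_whiskerRight]
  refine forall_congr' fun Z => ?_
  rw [← cancel_epi ((ρ_ _).inv ▷ _)]
  refine Eq.congr ?_ ?_ <;> (try simp only [join, cup])
  all_goals monoidal

lemma join_join_left_iff {A X : C} {m : A ⊗ A ⟶ A} {a : A ⊗ X ⟶ X} :
    A ◁ a ≫ a = (α_ A A X).inv ≫ m ▷ X ≫ a ↔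
      ∀ Z, A ◁ join a Z ≫ join a Z = join m (X ⊗ Z) ≫ join a Z := by
  rw [← forall_whiskerRight]
  refine forall_congr' fun Z => ?_
  rw [← cancel_epi (A ◁ (α_ _ _ _).inv ≫ (α_ _ _ _).inv)]
  refine Eq.congr ?_ ?_ <;> (try simp only [join])
  all_goals monoidal

lemma cup_join_left_iff {A X : C} {e : 𝟙_ C ⟶ A} {a : A ⊗ X ⟶ X} :
    e ▷ X ≫ a = (λ_ X).hom ↔ ∀ Z, cup e (X ⊗ Z) ≫ join a Z = 𝟙 _ := by
  rw [← forall_whiskerRight]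
  refine forall_congr' fun Z => ?_
  rw [← cancel_epi ((λ_ _).inv ▷ _)]
  refine Eq.congr ?_ ?_ <;> (try simp only [join, cup])
  all_goals monoidal

lemma fork_fork_right_iff {A X : C} {d : A ⟶ A ⊗ A} {c : X ⟶ X ⊗ A} :
    c ≫ c ▷ A = c ≫ X ◁ d ≫ (α_ X A A).inv ↔
      ∀ Z, fork c Z ≫ fork c (A ⊗ Z) = fork c Z ≫ X ◁ fork d Z := by
  rw [← forall_whiskerRight]
  refine forall_congr' fun Z => ?_
  rw [← cancel_mono ((α_ _ _ _).hom ≫ (α_ _ _ _).hom)]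
  refine Eq.congr ?_ ?_ <;> (try simp only [fork])
  all_goals monoidal

lemma fork_cap_right_iff {A X : C} {e : A ⟶ 𝟙_ C} {c : X ⟶ X ⊗ A} :
    c ≫ X ◁ e = (ρ_ X).inv ↔ ∀ Z, fork c Z ≫ X ◁ cap e Z = 𝟙 _ := by
  rw [← forall_whiskerRight]
  refine forall_congr' fun Z => ?_
  rw [← cancel_mono ((ρ_ _).hom ▷ _)]
  refine Eq.congr ?_ ?_ <;> (try simp only [fork, cap])
  all_goals monoidal

lemma fork_fork_left_iff {A X : C} {d : A ⟶ A ⊗ A} {c : X ⟶ A ⊗ X} :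
    c ≫ A ◁ c = c ≫ d ▷ X ≫ (α_ A A X).hom ↔
      ∀ Z, fork c Z ≫ A ◁ fork c Z = fork c Z ≫ fork d (X ⊗ Z) := by
  rw [← forall_whiskerRight]
  refine forall_congr' fun Z => ?_
  rw [← cancel_mono ((α_ _ _ _).hom ≫ A ◁ (α_ _ _ _).hom)]
  refine Eq.congr ?_ ?_ <;> (try simp only [fork])
  all_goals monoidal

lemma fork_cap_left_iff {A X : C} {e : A ⟶ 𝟙_ C} {c : X ⟶ A ⊗ X} :
    c ≫ e ▷ X = (λ_ X).inv ↔ ∀ Z, fork c Z ≫ cap e (X ⊗ Z) = 𝟙 _ := by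
  rw [← forall_whiskerRight]
  refine forall_congr' fun Z => ?_
  rw [← cancel_mono ((λ_ _).hom ▷ _)]
  refine Eq.congr ?_ ?_ <;> (try simp only [fork, cap])
  all_goals monoidal

lemma join_join_bimod_iff {A X : C} {l : A ⊗ X ⟶ X} {r : X ⊗ A ⟶ X} :
    l ▷ A ≫ r = (α_ A X A).hom ≫ A ◁ r ≫ l ↔
      ∀ Z, join l (A ⊗ Z) ≫ join r Z = A ◁ join r Z ≫ join l Z := by
  rw [← forall_whiskerRight]
  refine forall_congr' fun Z => ?_
  rw [← cancel_epi ((α_ _ _ _).inv ≫ (α_ _ _ _).inv)]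
  refine Eq.congr ?_ ?_ <;> (try simp only [join])
  all_goals monoidal

lemma fork_fork_bicomod_iff {A X : C} {l : X ⟶ A ⊗ X} {r : X ⟶ X ⊗ A} :
    l ≫ A ◁ r = r ≫ l ▷ A ≫ (α_ A X A).hom ↔
      ∀ Z, fork l Z ≫ A ◁ fork r Z = fork r Z ≫ fork l (A ⊗ Z) := by
  rw [← forall_whiskerRight]
  refine forall_congr' fun Z => ?_
  rw [← cancel_mono ((α_ _ _ _).hom ≫ A ◁ (α_ _ _ _).hom)]
  refine Eq.congr ?_ ?_ <;> (try simp only [fork])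
  all_goals monoidal

variable [BraidedCategory C]

/-- The compatibility of an action or multiplication `a` with a coaction or comultiplication `c`, as
in the axioms of a bialgebra and of a Hopf bimodule, in terms of actions on first factors. -/
lemma join_fork_iff {P Q S X Y A B D E : C} {a : P ⊗ Q ⟶ S} {c : S ⟶ X ⊗ Y}
    {f : P ⟶ A ⊗ B} {g : Q ⟶ D ⊗ E} {h : A ⊗ D ⟶ X} {k : B ⊗ E ⟶ Y} :
    a ≫ c = (f ⊗ₘ g) ≫ tensorμ A B D E ≫ (h ⊗ₘ k) ↔
      ∀ Z, join a Z ≫ fork c Z = P ◁ fork g Z ≫ fork f (D ⊗ (E ⊗ Z)) ≫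
        A ◁ cross B D (E ⊗ Z) ≫ A ◁ D ◁ join k Z ≫ join h (Y ⊗ Z) := by
  rw [← forall_whiskerRight]
  refine forall_congr' fun Z => ?_
  rw [← cancel_epi ((α_ _ _ _).inv), ← cancel_mono (α_ _ _ _).hom,
    MonoidalCategory.tensorHom_def' f, MonoidalCategory.tensorHom_def' h]
  refine Eq.congr ?_ ?_ <;> simp only [join, fork, cross, tensorμ] <;> monoidal

/-- The compatibility condition of a crossed module in terms of actions on first factors. -/
lemma crossed_iff {B X : C} {d : B ⟶ B ⊗ B} {m : B ⊗ B ⟶ B} {a : X ⊗ B ⟶ X} {c : X ⟶ X ⊗ B} :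
    X ◁ d ≫ (α_ X B B).inv ≫ (β_ X B).hom ▷ B ≫ (α_ B X B).hom ≫ B ◁ (a ≫ c) ≫
        (α_ B X B).inv ≫ (β_ B X).hom ▷ B ≫ (α_ X B B).hom ≫ X ◁ m =
      (c ⊗ₘ d) ≫ tensorμ X B B B ≫ (a ⊗ₘ m) ↔
    ∀ Z, X ◁ fork d Z ≫ cross X B (B ⊗ Z) ≫ B ◁ join a Z ≫ B ◁ fork c Z ≫ cross B X (B ⊗ Z) ≫
        X ◁ join m Z =
      X ◁ fork d Z ≫ fork c (B ⊗ (B ⊗ Z)) ≫ X ◁ cross B B (B ⊗ Z) ≫ X ◁ B ◁ join m Z ≫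
        join a (B ⊗ Z) := by
  rw [← forall_whiskerRight]
  refine forall_congr' fun Z => ?_
  rw [← cancel_epi ((α_ _ _ _).inv), ← cancel_mono (α_ _ _ _).hom,
    MonoidalCategory.tensorHom_def' c, MonoidalCategory.tensorHom_def' a]
  refine Eq.congr ?_ ?_ <;> simp only [join, fork, cross, tensorμ] <;> monoidal

end Word

variable {C : Type u} [Category.{v} C] [MonoidalCategory C] [BraidedCategory C]

open Word

/-! ### Diagonal and induced actions and coactions -/

namespace Word
variable {A X Y Z W : C}
lemma join_diagRightAct [ComonObj A] (a : X ⊗ A ⟶ X) (b : Y ⊗ A ⟶ Y) (Z : C) :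
    join (diagRightAct a b) Z = (α_ X Y (A ⊗ Z)).hom ≫ X ◁ Y ◁ fork Δ Z ≫
      X ◁ cross Y A (A ⊗ Z) ≫ X ◁ A ◁ join b Z ≫ join a (Y ⊗ Z) ≫ (α_ X Y Z).inv := by
  rw [diagRightAct, MonoidalCategory.tensorHom_def']
  simp only [join, fork, cross, tensorμ]
  monoidal

lemma fork_diagRightCoact [MonObj A] (a : X ⟶ X ⊗ A) (b : Y ⟶ Y ⊗ A) (Z : C) :
    fork (diagRightCoact a b) Z = (α_ X Y Z).hom ≫ X ◁ fork b Z ≫ fork a (Y ⊗ (A ⊗ Z)) ≫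
      X ◁ cross A Y (A ⊗ Z) ≫ X ◁ Y ◁ join μ Z ≫ (α_ X Y (A ⊗ Z)).inv := by
  rw [diagRightCoact, MonoidalCategory.tensorHom_def']
  simp only [join, fork, cross, tensorμ]
  monoidal

lemma join_inducedLeftAct (a : A ⊗ X ⟶ X) (Y Z : C) :
    join (inducedLeftAct a Y) Z = A ◁ (α_ X Y Z).hom ≫ join a (Y ⊗ Z) ≫ (α_ X Y Z).inv := by
  simp only [join, inducedLeftAct]
  monoidal

lemma fork_inducedLeftCoact (a : X ⟶ A ⊗ X) (Y Z : C) :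
    fork (inducedLeftCoact a Y) Z = (α_ X Y Z).hom ≫ fork a (Y ⊗ Z) ≫ A ◁ (α_ X Y Z).inv := by
  simp only [fork, inducedLeftCoact]
  monoidal

lemma cross_tensor_left (X Y W Z : C) :
    cross (X ⊗ Y) W Z = (α_ X Y (W ⊗ Z)).hom ≫ X ◁ cross Y W Z ≫ cross X W (Y ⊗ Z) ≫
      W ◁ (α_ X Y Z).inv := by
  simp only [cross, braiding_tensor_left_hom]
  monoidal

lemma cross_tensor_right (X Y W Z : C) :
    cross W (X ⊗ Y) Z = W ◁ (α_ X Y Z).hom ≫ cross W X (Y ⊗ Z) ≫ X ◁ cross W Y Z ≫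
      (α_ X Y (W ⊗ Z)).inv := by
  simp only [cross, braiding_tensor_right_hom]
  monoidal

lemma join_mul_assoc [MonObj A] (Z : C) :
    join μ[A] (A ⊗ Z) ≫ join μ[A] Z = A ◁ join μ[A] Z ≫ join μ[A] Z :=
  join_join_right_iff.1 (MonObj.mul_assoc A) Z

lemma fork_comul_assoc [ComonObj A] (Z : C) :
    fork Δ[A] Z ≫ fork Δ[A] (A ⊗ Z) = fork Δ[A] Z ≫ A ◁ fork Δ[A] Z :=
  fork_fork_right_iff.1 (by simp) Z

end Word

/-- The diagonal right action and coaction on `X ⊗ V` are compatible if those on `X` are and `V` is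
a crossed module. This is the only axiom of a Hopf bimodule for `M ⊗ V` that uses the compatibility
condition of `V`. -/
lemma tensorCrossed_ract_rcoact {H : C} [BimonObj H] {X V : C} {a : X ⊗ H ⟶ X}
    {c : X ⟶ X ⊗ H} {b : V ⊗ H ⟶ V} {d : V ⟶ V ⊗ H}
    (h : a ≫ c = (c ⊗ₘ Δ) ≫ tensorμ X H H H ≫ (a ⊗ₘ μ)) (hV : IsCrossedModule H b d) :
    diagRightAct a b ≫ diagRightCoact c d =
      (diagRightCoact c d ⊗ₘ Δ) ≫ tensorμ (X ⊗ V) H H H ≫ (diagRightAct a b ⊗ₘ μ) := by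
  rw [join_fork_iff] at h ⊢
  intro Z
  have hc := crossed_iff.1 hV.compatibility
  simp only [join_diagRightAct, fork_diagRightCoact, Category.assoc, Iso.inv_hom_id_assoc]
  rw [← cancel_epi (α_ _ _ _).inv, ← cancel_mono (α_ _ _ _).hom]
  simp only [Category.assoc, Iso.inv_hom_id_assoc, Iso.inv_hom_id, Category.comp_id,
    MonoidalCategory.tensor_whiskerLeft]
  rw [reassoc_of% join_exchange a, reassoc_of% h]
  rw [reassoc_of% join_exchange a, join_exchange a,
    reassoc_of% (whisk₂₃ X (whisk₂₃ H (join_cross_left _))),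
    reassoc_of% (whisk₂₂ X (whisk₂₂ H (whisk₂₂ V (join_mul_assoc Z)))),
    reassoc_of% (whisk₂₂ X (whisk₂₂ H (cross_exchange _))),
    reassoc_of% (whisk₂₂ X (cross_exchange _)),
    reassoc_of% (whisk₂₂ X (cross_exchange _)),
    reassoc_of% fork_exchange c, reassoc_of% fork_exchange c,
    ← reassoc_of% (whisk₂₂ X (fork_exchange Δ (fork d Z))),
    ← reassoc_of% (whisk₂₂ X (fork_exchange Δ (join b Z))),
    reassoc_of% (whisk₂₃ X (fork_cross Δ[H]).symm),
    reassoc_of% (whisk₂₂ X (whisk₂₂ V (fork_comul_assoc Z))),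
    ← reassoc_of% (whisk₂₂ X (cross_exchange (fork Δ Z)))]
  -- the action and coaction of `V` now meet in the left side of its compatibility condition
  have hc' := congrArg (X ◁ H ◁ ·) (hc Z)
  simp only [MonoidalCategory.whiskerLeft_comp] at hc'
  rw [reassoc_of% hc',
    reassoc_of% (whisk₂₂ X (cross_exchange (fork Δ Z))),
    reassoc_of% (whisk₂₃ X (fork_cross_left d).symm)]
  iterate 4 rw [← reassoc_of% (fork_exchange c)]
  iterate 3 rw [← reassoc_of% (whisk₂₂ X (cross_exchange _))]
  rw [reassoc_of% (whisk₂₃ X (whisk₂₃ H (join_cross b)))]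
  iterate 2 rw [← reassoc_of% (whisk₂₂ X (whisk₂₂ H (cross_exchange _)))]
  rw [reassoc_of% (whisk₃₃ X cross_cross),
    reassoc_of% (whisk₂₂ X (whisk₂₂ H (join_exchange b _))),
    ← reassoc_of% (whisk₂₂ X (whisk₂₂ H (whisk₂₂ V (cross_exchange _))))]
  iterate 4 rw [reassoc_of% (whisk₂₂ X (cross_exchange _))]
  symm
  rw [← reassoc_of% (whisk₂₂ X (whisk₂₂ V (fork_exchange Δ (join μ Z)))),
    reassoc_of% (whisk₂₃ X (whisk₂₃ V (fork_cross Δ[H]).symm)),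
    reassoc_of% (whisk₂₂ X (whisk₂₂ V (join_exchange _ _))),
    reassoc_of% (whisk₂₂ X (cross_exchange _)), reassoc_of% fork_exchange c,
    reassoc_of% (whisk₂₂ X (fork_exchange d _)),
    reassoc_of% (whisk₂₂ X (whisk₂₂ V (fork_comul_assoc Z))),
    reassoc_of% (whisk₂₃ X (whisk₂₃ V (join_cross_left _))),
    reassoc_of% (whisk₂₃ X (whisk₂₃ V (whisk₂₃ H (join_cross_left _)))),
    reassoc_of% (whisk₂₂ X (whisk₂₂ V (whisk₂₂ H (whisk₂₂ H (join_mul_assoc Z))))),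
    reassoc_of% (whisk₂₂ X (cross_exchange _)), reassoc_of% fork_exchange c]

/-! ### The tensor product of a Hopf bimodule and a crossed module -/

namespace Word
variable {A : C} [BimonObj A]

lemma cup_fork_comul (Z : C) : cup η[A] Z ≫ fork Δ[A] Z = cup η[A] Z ≫ cup η[A] (A ⊗ Z) := by
  have h := congrArg (fun t => (λ_ Z).inv ≫ t ▷ Z ≫ (α_ _ _ _).hom) (BimonObj.one_comul A)
  refine Eq.trans ?_ (h.trans ?_)
  · simp only [cup, fork]; monoidal
  · simp only [cup, MonoidalCategory.tensorHom_def', MonObj.tensorObj.one_def]; monoidal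

lemma join_mul_cap (Z : C) : join μ[A] Z ≫ cap ε[A] Z = A ◁ cap ε[A] Z ≫ cap ε[A] Z := by
  have h := congrArg (fun t => (α_ _ _ _).inv ≫ t ▷ Z ≫ (λ_ Z).hom) (BimonObj.mul_counit A)
  refine Eq.trans ?_ (h.trans ?_)
  · simp only [cap, join]; monoidal
  · simp only [cap, MonoidalCategory.tensorHom_def', Comon.tensorObj_counit]; monoidal

lemma join_mul_fork_comul (Z : C) : join μ[A] Z ≫ fork Δ[A] Z =
    A ◁ fork Δ[A] Z ≫ fork Δ[A] (A ⊗ (A ⊗ Z)) ≫ A ◁ cross A A (A ⊗ Z) ≫ A ◁ A ◁ join μ[A] Z ≫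
      join μ[A] (A ⊗ Z) :=
  join_fork_iff.1 (by simp) Z

end Word

variable {H : C} [BimonObj H] {X V : C}

lemma IsRightModule.diag {a : X ⊗ H ⟶ X} {b : V ⊗ H ⟶ V} (ha : IsRightModule H a)
    (hb : IsRightModule H b) : IsRightModule H (diagRightAct a b) where
  one_act := by
    have ha₁ := cup_join_right_iff.1 ha.one_act
    have hb₁ := cup_join_right_iff.1 hb.one_act
    rw [cup_join_right_iff]
    intro Z
    rw [← cancel_epi (α_ _ _ _).inv, ← cancel_mono (α_ _ _ _).hom]
    simp only [join_diagRightAct, MonoidalCategory.tensor_whiskerLeft, Category.assoc,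
      Iso.inv_hom_id_assoc, Iso.inv_hom_id, Category.comp_id]
    rw [reassoc_of% (whisk₂₂ X (whisk₂₂ V (cup_fork_comul Z))),
      reassoc_of% (whisk₂₁ X (cup_cross _)),
      reassoc_of% (whisk₂₂ X (cup_exchange _ _)), ha₁, Category.comp_id, whisk₂₀ X (hb₁ Z)]
  act_act := by
    have ha₂ := join_join_right_iff.1 ha.act_act
    have hb₂ := join_join_right_iff.1 hb.act_act
    rw [join_join_right_iff]
    intro Z
    rw [← cancel_epi (α_ _ _ _).inv, ← cancel_mono (α_ _ _ _).hom]
    simp only [join_diagRightAct, MonoidalCategory.tensor_whiskerLeft, Category.assoc,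
      Iso.inv_hom_id_assoc, Iso.inv_hom_id, Category.comp_id]
    have hH := congrArg (X ◁ V ◁ ·) (join_mul_fork_comul (A := H) Z)
    simp only [MonoidalCategory.whiskerLeft_comp] at hH
    iterate 3 rw [reassoc_of% (join_exchange a)]
    rw [reassoc_of% (whisk₂₂ X (whisk₂₂ H (join_exchange b _))),
      reassoc_of% (whisk₂₃ X (whisk₂₃ H (join_cross_left b))),
      reassoc_of% (whisk₂₂ X (cross_exchange _)), reassoc_of% (whisk₂₂ X (cross_exchange _)),
      reassoc_of% (whisk₂₂ X (whisk₂₂ V (fork_exchange _ _))),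
      reassoc_of% hH, reassoc_of% (whisk₂₃ X (join_cross _)),
      reassoc_of% (whisk₂₂ X (join_exchange _ _)), ← ha₂,
      ← reassoc_of% (whisk₂₂ X (cross_exchange (H ◁ join μ[H] Z))),
      ← reassoc_of% (whisk₂₂ X (whisk₂₂ H (cross_exchange (join μ[H] Z)))),
      ← reassoc_of% (whisk₂₂ X (whisk₂₂ H (whisk₂₂ H (hb₂ Z))))]

lemma IsRightComodule.diag {c : X ⟶ X ⊗ H} {d : V ⟶ V ⊗ H} (hc : IsRightComodule H c)
    (hd : IsRightComodule H d) : IsRightComodule H (diagRightCoact c d) where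
  coact_counit := by
    have hc₁ := fork_cap_right_iff.1 hc.coact_counit
    have hd₁ := fork_cap_right_iff.1 hd.coact_counit
    rw [fork_cap_right_iff]
    intro Z
    rw [← cancel_epi (α_ _ _ _).inv, ← cancel_mono (α_ _ _ _).hom]
    simp only [fork_diagRightCoact, MonoidalCategory.tensor_whiskerLeft, Category.assoc,
      Iso.inv_hom_id_assoc, Iso.inv_hom_id, Category.comp_id]
    rw [whisk₂₂ X (whisk₂₂ V (join_mul_cap Z)), reassoc_of% (whisk₂₂ X (cross_exchange _)),
      whisk₂₁ X (cross_cap_left _), reassoc_of% fork_exchange c, hc₁, Category.comp_id,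
      whisk₂₀ X (hd₁ Z)]
  coact_coact := by
    have hc₂ := fork_fork_right_iff.1 hc.coact_coact
    have hd₂ := fork_fork_right_iff.1 hd.coact_coact
    rw [fork_fork_right_iff]
    intro Z
    rw [← cancel_epi (α_ _ _ _).inv, ← cancel_mono (α_ _ _ _).hom]
    simp only [fork_diagRightCoact, MonoidalCategory.tensor_whiskerLeft, Category.assoc,
      Iso.inv_hom_id_assoc, Iso.inv_hom_id, Category.comp_id]
    have hH := congrArg (X ◁ V ◁ ·) (join_mul_fork_comul (A := H) Z)
    simp only [MonoidalCategory.whiskerLeft_comp] at hH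
    rw [← reassoc_of% (whisk₂₂ X (fork_exchange d _)), reassoc_of% (whisk₂₃ X (fork_cross d).symm),
      reassoc_of% fork_exchange c]
    rw [← reassoc_of% (fork_exchange c (V ◁ H ◁ join μ[H] Z)),
      ← reassoc_of% (fork_exchange c (V ◁ cross H H (H ⊗ Z))),
      ← reassoc_of% (fork_exchange c (cross H V (H ⊗ H ⊗ Z)))]
    iterate 2 rw [← reassoc_of% (whisk₂₂ X (cross_exchange _))]
    symm
    rw [hH, reassoc_of% (whisk₂₂ X (cross_exchange _)), reassoc_of% fork_exchange c,
      ← reassoc_of% (whisk₂₂ X (hd₂ Z)), reassoc_of% (whisk₂₃ X (fork_cross_left _).symm),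
      ← reassoc_of% hc₂]

lemma IsLeftModule.induced {a : H ⊗ X ⟶ X} (ha : IsLeftModule H a) (Y : C) :
    IsLeftModule H (inducedLeftAct a Y) where
  one_act := by
    have ha₁ := cup_join_left_iff.1 ha.one_act
    rw [cup_join_left_iff]
    intro Z
    rw [← cancel_epi (α_ _ _ _).inv, ← cancel_mono (α_ _ _ _).hom]
    simp only [join_inducedLeftAct, Category.assoc, Iso.inv_hom_id, Category.comp_id]
    rw [reassoc_of% cup_exchange, Iso.inv_hom_id_assoc, ha₁]
  act_act := by
    have ha₂ := join_join_left_iff.1 ha.act_act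
    rw [join_join_left_iff]
    intro Z
    rw [← cancel_epi (H ◁ H ◁ (α_ _ _ _).inv), ← cancel_mono (α_ _ _ _).hom]
    simp only [join_inducedLeftAct, Category.assoc, Iso.inv_hom_id, Category.comp_id,
      MonoidalCategory.whiskerLeft_comp, MonoidalCategory.whiskerLeft_inv_hom_assoc]
    rw [reassoc_of% join_exchange, ha₂, ← reassoc_of% (join_exchange μ[H])]

lemma IsLeftComodule.induced {a : X ⟶ H ⊗ X} (ha : IsLeftComodule H a) (Y : C) :
    IsLeftComodule H (inducedLeftCoact a Y) where
  coact_counit := by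
    have ha₁ := fork_cap_left_iff.1 ha.coact_counit
    rw [fork_cap_left_iff]
    intro Z
    rw [← cancel_epi (α_ _ _ _).inv, ← cancel_mono (α_ _ _ _).hom]
    simp only [fork_inducedLeftCoact, Category.assoc, Iso.inv_hom_id_assoc, Category.comp_id]
    rw [← reassoc_of% cap_exchange, Iso.inv_hom_id, Category.comp_id, ha₁]
  coact_coact := by
    have ha₂ := fork_fork_left_iff.1 ha.coact_coact
    rw [fork_fork_left_iff]
    intro Z
    rw [← cancel_epi (α_ _ _ _).inv, ← cancel_mono (H ◁ H ◁ (α_ _ _ _).hom)]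
    simp only [fork_inducedLeftCoact, Category.assoc,
      MonoidalCategory.whiskerLeft_comp, MonoidalCategory.whiskerLeft_inv_hom_assoc]
    simp only [Iso.inv_hom_id_assoc]
    rw [whisk₂₀ H (whisk₂₀ H (α_ X Y Z).inv_hom_id), Category.comp_id, ha₂, fork_exchange,
      reassoc_of% (whisk₂₀ H (α_ X Y Z).inv_hom_id)]

lemma tensorCrossed_lact_ract {l : H ⊗ X ⟶ X} {a : X ⊗ H ⟶ X} (b : V ⊗ H ⟶ V)
    (h : l ▷ H ≫ a = (α_ H X H).hom ≫ H ◁ a ≫ l) :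
    inducedLeftAct l V ▷ H ≫ diagRightAct a b =
      (α_ H (X ⊗ V) H).hom ≫ H ◁ diagRightAct a b ≫ inducedLeftAct l V := by
  rw [join_join_bimod_iff] at h ⊢
  intro Z
  rw [← cancel_epi (H ◁ (α_ _ _ _).inv), ← cancel_mono (α_ _ _ _).hom]
  simp only [join_inducedLeftAct, join_diagRightAct, Category.assoc, Iso.inv_hom_id_assoc,
    MonoidalCategory.whiskerLeft_comp, Iso.inv_hom_id, Category.comp_id,
    MonoidalCategory.whiskerLeft_inv_hom_assoc]
  iterate 3 rw [reassoc_of% (join_exchange l)]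
  rw [h]

lemma tensorCrossed_lcoact_rcoact {l : X ⟶ H ⊗ X} {c : X ⟶ X ⊗ H} (d : V ⟶ V ⊗ H)
    (h : l ≫ H ◁ c = c ≫ l ▷ H ≫ (α_ H X H).hom) :
    inducedLeftCoact l V ≫ H ◁ diagRightCoact c d =
      diagRightCoact c d ≫ inducedLeftCoact l V ▷ H ≫ (α_ H (X ⊗ V) H).hom := by
  rw [fork_fork_bicomod_iff] at h ⊢
  intro Z
  rw [← cancel_epi (α_ _ _ _).inv, ← cancel_mono (H ◁ (α_ _ _ _).hom)]
  simp only [fork_inducedLeftCoact, fork_diagRightCoact, Category.assoc, Iso.inv_hom_id_assoc,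
    MonoidalCategory.whiskerLeft_comp, Category.comp_id,
    MonoidalCategory.whiskerLeft_inv_hom_assoc, MonoidalCategory.whiskerLeft_inv_hom]
  rw [reassoc_of% (fork_exchange l), reassoc_of% h, reassoc_of% (fork_exchange l),
    (fork_exchange l)]

lemma tensorCrossed_lact_lcoact {l : H ⊗ X ⟶ X} {c : X ⟶ H ⊗ X} (V : C)
    (h : l ≫ c = (Δ ⊗ₘ c) ≫ tensorμ H H H X ≫ (μ ⊗ₘ l)) :
    inducedLeftAct l V ≫ inducedLeftCoact c V =
      (Δ ⊗ₘ inducedLeftCoact c V) ≫ tensorμ H H H (X ⊗ V) ≫ (μ ⊗ₘ inducedLeftAct l V) := by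
  rw [join_fork_iff] at h ⊢
  intro Z
  rw [← cancel_epi (H ◁ (α_ _ _ _).inv), ← cancel_mono (H ◁ (α_ _ _ _).hom)]
  simp only [join_inducedLeftAct, fork_inducedLeftCoact, Category.assoc, Iso.inv_hom_id_assoc,
    MonoidalCategory.whiskerLeft_comp, Category.comp_id,
    MonoidalCategory.whiskerLeft_inv_hom_assoc, MonoidalCategory.whiskerLeft_inv_hom]
  rw [h, join_exchange μ[H]]
  rw [reassoc_of% (whisk₂₀ H (whisk₂₀ H (α_ X V Z).inv_hom_id)),
    reassoc_of% (whisk₂₂ H (cross_exchange (α_ X V Z).hom)), reassoc_of% fork_exchange,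
    reassoc_of% (whisk₂₀ H (whisk₂₀ H (α_ X V Z).inv_hom_id))]

lemma tensorCrossed_ract_lcoact {a : X ⊗ H ⟶ X} {c : X ⟶ H ⊗ X} (b : V ⊗ H ⟶ V)
    (h : a ≫ c = (c ⊗ₘ Δ) ≫ tensorμ H X H H ≫ (μ ⊗ₘ a)) :
    diagRightAct a b ≫ inducedLeftCoact c V =
      (inducedLeftCoact c V ⊗ₘ Δ) ≫ tensorμ H (X ⊗ V) H H ≫ (μ ⊗ₘ diagRightAct a b) := by
  rw [join_fork_iff] at h ⊢
  intro Z
  rw [← cancel_epi (α_ _ _ _).inv, ← cancel_mono (H ◁ (α_ _ _ _).hom)]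
  simp only [join_diagRightAct, fork_inducedLeftCoact, cross_tensor_left, Category.assoc,
    Iso.inv_hom_id_assoc,
    MonoidalCategory.whiskerLeft_comp, Category.comp_id,
    MonoidalCategory.whiskerLeft_inv_hom_assoc, MonoidalCategory.whiskerLeft_inv_hom]
  rw [join_exchange μ[H]]
  simp only [MonoidalCategory.tensor_whiskerLeft, Category.assoc, Iso.inv_hom_id_assoc]
  rw [h, reassoc_of% (whisk₂₂ X (fork_exchange Δ (join b Z))).symm,
    reassoc_of% (whisk₂₃ X (fork_cross Δ[H]).symm),
    reassoc_of% (whisk₂₂ X (whisk₂₂ V (fork_comul_assoc Z)))]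
  iterate 4 rw [← reassoc_of% (fork_exchange c)]
  rw [reassoc_of% (whisk₂₀ H (whisk₂₀ H (α_ X V Z).inv_hom_id)),
    reassoc_of% (whisk₂₀ H (whisk₂₀ H (α_ X V (H ⊗ Z)).inv_hom_id)),
    reassoc_of% (whisk₂₂ H (cross_exchange _)), reassoc_of% (whisk₂₂ H (cross_exchange _)),
    reassoc_of% (whisk₂₂ H (cross_exchange _)),
    reassoc_of% (whisk₂₂ H (whisk₂₂ X (cross_exchange _)))]

lemma tensorCrossed_lact_rcoact {l : H ⊗ X ⟶ X} {c : X ⟶ X ⊗ H} (d : V ⟶ V ⊗ H)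
    (h : l ≫ c = (Δ ⊗ₘ c) ≫ tensorμ H H X H ≫ (l ⊗ₘ μ)) :
    inducedLeftAct l V ≫ diagRightCoact c d =
      (Δ ⊗ₘ diagRightCoact c d) ≫ tensorμ H H (X ⊗ V) H ≫ (inducedLeftAct l V ⊗ₘ μ) := by
  rw [join_fork_iff] at h ⊢
  intro Z
  rw [← cancel_epi (H ◁ (α_ _ _ _).inv), ← cancel_mono (α_ _ _ _).hom]
  simp only [join_inducedLeftAct, fork_diagRightCoact, cross_tensor_right, Category.assoc,
    Iso.inv_hom_id_assoc,
    MonoidalCategory.whiskerLeft_comp, Iso.inv_hom_id, Category.comp_id,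
    MonoidalCategory.whiskerLeft_inv_hom_assoc]
  rw [reassoc_of% join_exchange l, reassoc_of% h, reassoc_of% join_exchange l, join_exchange l]
  rw [reassoc_of% (whisk₂₃ H (whisk₂₃ X (join_cross_left _))),
    reassoc_of% (whisk₂₂ H (whisk₂₂ X (whisk₂₂ V (join_mul_assoc Z))))]
  rw [reassoc_of% (fork_exchange Δ (α_ X V (H ⊗ Z)).hom),
    reassoc_of% (whisk₂₀ H (α_ X V (H ⊗ Z)).inv_hom_id),
    ← reassoc_of% (fork_exchange Δ (X ◁ V ◁ join μ[H] Z)),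
    ← reassoc_of% (fork_exchange Δ (X ◁ cross H V (H ⊗ Z))),
    ← reassoc_of% (whisk₂₂ H (cross_exchange _)), ← reassoc_of% (whisk₂₂ H (cross_exchange _)),
    ← reassoc_of% (whisk₂₂ H (whisk₂₂ X (cross_exchange _)))]
  simp only [MonoidalCategory.tensor_whiskerLeft, MonoidalCategory.whiskerLeft_comp, Category.assoc,
    MonoidalCategory.whiskerLeft_inv_hom_assoc]

instance HopfBimodule.tensorCrossedClosed : HopfBimodule.TensorCrossedClosed H where
  tensorCrossed M V :=
    { isLeftModule := M.isHopfBimodule.isLeftModule.induced V.X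
      isRightModule := M.isHopfBimodule.isRightModule.diag V.isCrossedModule.isRightModule
      lact_ract := tensorCrossed_lact_ract V.act M.isHopfBimodule.lact_ract
      isLeftComodule := M.isHopfBimodule.isLeftComodule.induced V.X
      isRightComodule := M.isHopfBimodule.isRightComodule.diag V.isCrossedModule.isRightComodule
      lcoact_rcoact := tensorCrossed_lcoact_rcoact V.coact M.isHopfBimodule.lcoact_rcoact
      lact_lcoact := tensorCrossed_lact_lcoact V.X M.isHopfBimodule.lact_lcoact
      ract_lcoact := tensorCrossed_ract_lcoact V.act M.isHopfBimodule.ract_lcoact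
      lact_rcoact := tensorCrossed_lact_rcoact V.coact M.isHopfBimodule.lact_rcoact
      ract_rcoact := tensorCrossed_ract_rcoact M.isHopfBimodule.ract_rcoact V.isCrossedModule }

/-! ### The antipode and the projection onto the invariants -/

namespace Word
variable {H : C} [HopfObj H]

lemma fork_antipode_left (Z : C) :
    fork Δ[H] Z ≫ 𝒮[H] ▷ (H ⊗ Z) ≫ join μ[H] Z = cap ε[H] Z ≫ cup η[H] Z := by
  have h := congrArg (· ▷ Z) (HopfObj.antipode_left H)
  refine Eq.trans ?_ (h.trans ?_)
  · simp only [fork, join]; monoidal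
  · simp only [cap, cup]; monoidal

lemma fork_antipode_right (Z : C) :
    fork Δ[H] Z ≫ H ◁ 𝒮[H] ▷ Z ≫ join μ[H] Z = cap ε[H] Z ≫ cup η[H] Z := by
  have h := congrArg (· ▷ Z) (HopfObj.antipode_right H)
  refine Eq.trans ?_ (h.trans ?_)
  · simp only [fork, join]; monoidal
  · simp only [cap, cup]; monoidal

/-- The antipode reverses the comultiplication. -/
lemma antipode_fork (Z : C) : 𝒮[H] ▷ Z ≫ fork Δ[H] Z =
    fork Δ[H] Z ≫ cross H H Z ≫ H ◁ 𝒮[H] ▷ Z ≫ 𝒮[H] ▷ (H ⊗ Z) := by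
  have h := congrArg (fun t => t ▷ Z ≫ (α_ _ _ _).hom) (HopfObj.antipode_comul H)
  rw [MonoidalCategory.tensorHom_def'] at h
  refine Eq.trans ?_ (h.trans ?_) <;> simp only [fork, cross] <;> monoidal

/-- The antipode reverses the multiplication. -/
lemma join_antipode (Z : C) : join μ[H] Z ≫ 𝒮[H] ▷ Z =
    H ◁ 𝒮[H] ▷ Z ≫ 𝒮[H] ▷ (H ⊗ Z) ≫ cross H H Z ≫ join μ[H] Z := by
  have h := congrArg (fun t => (α_ _ _ _).inv ≫ t ▷ Z) (HopfObj.mul_antipode H)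
  rw [MonoidalCategory.tensorHom_def'] at h
  refine Eq.trans ?_ (h.trans ?_) <;> simp only [join, cross] <;> monoidal

lemma cup_antipode (Z : C) : cup η[H] Z ≫ 𝒮[H] ▷ Z = cup η[H] Z := by
  simp only [cup, Category.assoc, ← comp_whiskerRight, HopfObj.one_antipode]

lemma antipode_cap (Z : C) : 𝒮[H] ▷ Z ≫ cap ε[H] Z = cap ε[H] Z := by
  simp only [cap, ← comp_whiskerRight_assoc, HopfObj.antipode_counit]

lemma cup_join_mul_right (Z : C) : H ◁ cup η[H] Z ≫ join μ[H] Z = 𝟙 _ :=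
  cup_join_right_iff.1 (by simp) Z

lemma cup_join_mul_left (Z : C) : cup η[H] (H ⊗ Z) ≫ join μ[H] Z = 𝟙 _ :=
  cup_join_left_iff.1 (by simp) Z

lemma fork_comul_cap_right (Z : C) : fork Δ[H] Z ≫ H ◁ cap ε[H] Z = 𝟙 _ :=
  fork_cap_right_iff.1 (by simp) Z

lemma fork_comul_cap_left (Z : C) : fork Δ[H] Z ≫ cap ε[H] (H ⊗ Z) = 𝟙 _ :=
  fork_cap_left_iff.1 (by simp) Z

end Word

namespace HopfBimodule
variable {H : C} [HopfObj H] (M : HopfBimodule H)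

/-! The axioms of a Hopf bimodule in terms of actions on first factors. -/

lemma lact_lact (Z : C) : H ◁ join M.lact Z ≫ join M.lact Z = join μ[H] (M.X ⊗ Z) ≫ join M.lact Z :=
  join_join_left_iff.1 M.isHopfBimodule.isLeftModule.act_act Z

lemma one_lact (Z : C) : cup η[H] (M.X ⊗ Z) ≫ join M.lact Z = 𝟙 _ :=
  cup_join_left_iff.1 M.isHopfBimodule.isLeftModule.one_act Z

lemma ract_ract (Z : C) :
    join M.ract (H ⊗ Z) ≫ join M.ract Z = M.X ◁ join μ[H] Z ≫ join M.ract Z :=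
  join_join_right_iff.1 M.isHopfBimodule.isRightModule.act_act Z

lemma one_ract (Z : C) : M.X ◁ cup η[H] Z ≫ join M.ract Z = 𝟙 _ :=
  cup_join_right_iff.1 M.isHopfBimodule.isRightModule.one_act Z

lemma lcoact_lcoact (Z : C) :
    fork M.lcoact Z ≫ H ◁ fork M.lcoact Z = fork M.lcoact Z ≫ fork Δ[H] (M.X ⊗ Z) :=
  fork_fork_left_iff.1 M.isHopfBimodule.isLeftComodule.coact_coact Z

lemma lcoact_counit (Z : C) : fork M.lcoact Z ≫ cap ε[H] (M.X ⊗ Z) = 𝟙 _ :=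
  fork_cap_left_iff.1 M.isHopfBimodule.isLeftComodule.coact_counit Z

lemma rcoact_rcoact (Z : C) :
    fork M.rcoact Z ≫ fork M.rcoact (H ⊗ Z) = fork M.rcoact Z ≫ M.X ◁ fork Δ[H] Z :=
  fork_fork_right_iff.1 M.isHopfBimodule.isRightComodule.coact_coact Z

lemma rcoact_counit (Z : C) : fork M.rcoact Z ≫ M.X ◁ cap ε[H] Z = 𝟙 _ :=
  fork_cap_right_iff.1 M.isHopfBimodule.isRightComodule.coact_counit Z

lemma join_lact_ract (Z : C) :
    join M.lact (H ⊗ Z) ≫ join M.ract Z = H ◁ join M.ract Z ≫ join M.lact Z :=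
  join_join_bimod_iff.1 M.isHopfBimodule.lact_ract Z

lemma fork_lcoact_rcoact (Z : C) :
    fork M.lcoact Z ≫ H ◁ fork M.rcoact Z = fork M.rcoact Z ≫ fork M.lcoact (H ⊗ Z) :=
  fork_fork_bicomod_iff.1 M.isHopfBimodule.lcoact_rcoact Z

lemma join_lact_fork_lcoact (Z : C) : join M.lact Z ≫ fork M.lcoact Z =
    H ◁ fork M.lcoact Z ≫ fork Δ[H] (H ⊗ (M.X ⊗ Z)) ≫ H ◁ cross H H (M.X ⊗ Z) ≫
      H ◁ H ◁ join M.lact Z ≫ join μ[H] (M.X ⊗ Z) :=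
  join_fork_iff.1 M.isHopfBimodule.lact_lcoact Z

lemma join_ract_fork_lcoact (Z : C) : join M.ract Z ≫ fork M.lcoact Z =
    M.X ◁ fork Δ[H] Z ≫ fork M.lcoact (H ⊗ (H ⊗ Z)) ≫ H ◁ cross M.X H (H ⊗ Z) ≫
      H ◁ H ◁ join M.ract Z ≫ join μ[H] (M.X ⊗ Z) :=
  join_fork_iff.1 M.isHopfBimodule.ract_lcoact Z

lemma join_lact_fork_rcoact (Z : C) : join M.lact Z ≫ fork M.rcoact Z =
    H ◁ fork M.rcoact Z ≫ fork Δ[H] (M.X ⊗ (H ⊗ Z)) ≫ H ◁ cross H M.X (H ⊗ Z) ≫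
      H ◁ M.X ◁ join μ[H] Z ≫ join M.lact (H ⊗ Z) :=
  join_fork_iff.1 M.isHopfBimodule.lact_rcoact Z

lemma join_ract_fork_rcoact (Z : C) : join M.ract Z ≫ fork M.rcoact Z =
    M.X ◁ fork Δ[H] Z ≫ fork M.rcoact (H ⊗ (H ⊗ Z)) ≫ M.X ◁ cross H H (H ⊗ Z) ≫
      M.X ◁ H ◁ join μ[H] Z ≫ join M.ract (H ⊗ Z) :=
  join_fork_iff.1 M.isHopfBimodule.ract_rcoact Z

lemma proj_whiskerRight (Z : C) :
    proj M ▷ Z = fork M.lcoact Z ≫ 𝒮[H] ▷ (M.X ⊗ Z) ≫ join M.lact Z := by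
  simp only [proj, fork, join]
  monoidal

/-- The image of `Π` is coinvariant for the left coaction. -/
lemma proj_lcoact (Z : C) :
    proj M ▷ Z ≫ fork M.lcoact Z = proj M ▷ Z ≫ cup η[H] (M.X ⊗ Z) := by
  simp only [proj_whiskerRight, Category.assoc]
  rw [join_lact_fork_lcoact, reassoc_of% whiskerRight_exchange, reassoc_of% lcoact_lcoact,
    reassoc_of% antipode_fork, reassoc_of% whiskerRight_exchange,
    reassoc_of% (whisk₂₂ H (cross_whiskerRight_left 𝒮[H])), reassoc_of% fork_comul_assoc]
  -- in Sweedler notation the left side is `S(m₍₋₂₎) m₍₋₁₎ ⊗ S(m₍₋₃₎) · m₍₀₎`, and the antipode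
  -- identity removes its first factor
  have h := fork_cross (W := H) (Z := M.X ⊗ Z) Δ[H]
  rw [reassoc_of% h, reassoc_of% whiskerRight_exchange, reassoc_of% fork_exchange,
    reassoc_of% fork_exchange, fork_antipode_left, ← reassoc_of% cap_exchange,
    ← reassoc_of% cap_exchange, reassoc_of% cross_cap, ← reassoc_of% lcoact_lcoact]
  rw [reassoc_of% (whisk₂₀ H (lcoact_counit M Z))]

/-- Every Hopf bimodule is generated by the image of `Π`: in Sweedler notation,
`m = m₍₋₁₎ · Π(m₍₀₎)`. -/
lemma lcoact_proj_lact (Z : C) :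
    fork M.lcoact Z ≫ H ◁ proj M ▷ Z ≫ join M.lact Z = 𝟙 _ := by
  simp only [proj_whiskerRight, MonoidalCategory.whiskerLeft_comp, Category.assoc]
  rw [lact_lact, reassoc_of% lcoact_lcoact, reassoc_of% fork_antipode_right]
  rw [reassoc_of% lcoact_counit, one_lact]

/-- On `H ⊗ Π(M)` the left coaction of `M` restricts to the comultiplication of `H`. -/
lemma lact_lcoact_proj (Z : C) :
    H ◁ proj M ▷ Z ≫ join M.lact Z ≫ fork M.lcoact Z =
      H ◁ proj M ▷ Z ≫ fork Δ[H] (M.X ⊗ Z) ≫ H ◁ join M.lact Z := by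
  rw [join_lact_fork_lcoact, reassoc_of% (whisk₂₂ H (proj_lcoact M Z)), ← reassoc_of% fork_exchange,
    reassoc_of% (whisk₂₁ H (cup_cross _)), reassoc_of% (whisk₂₂ H (cup_exchange _ _))]
  rw [cup_join_mul_right, Category.comp_id]

/-- The projection onto the invariants turns the left action into the counit:
`Π(h · m) = ε(h) Π(m)`. -/
lemma lact_proj (Z : C) : join M.lact Z ≫ proj M ▷ Z = cap ε[H] (M.X ⊗ Z) ≫ proj M ▷ Z := by
  have h : H ◁ proj M ▷ Z ≫ join M.lact Z ≫ proj M ▷ Z =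
      cap ε[H] (M.X ⊗ Z) ≫ proj M ▷ Z := by
    nth_rw 2 [proj_whiskerRight]
    rw [reassoc_of% lact_lcoact_proj, ← reassoc_of% whiskerRight_exchange, lact_lact,
      reassoc_of% fork_antipode_left, one_lact, Category.comp_id, ← cap_exchange]
  -- the claim holds after restriction to `Π(M)`, which generates `M`
  have h' := (whisk₂₀ H (lcoact_proj_lact M Z))
  rw [MonoidalCategory.whiskerLeft_comp] at h'
  rw [← Category.id_comp (join M.lact Z), ← h']
  simp only [Category.assoc]
  rw [reassoc_of% lact_lact, ← reassoc_of% join_exchange, h]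
  rw [reassoc_of% join_mul_cap, reassoc_of% (whisk₂₀ H (lcoact_counit M Z))]

lemma proj_proj : proj M ≫ proj M = proj M := by
  rw [← forall_whiskerRight]
  intro Z
  have h := fun Z => antipode_cap (H := H) Z
  rw [comp_whiskerRight]
  nth_rw 1 [proj_whiskerRight]
  simp only [Category.assoc]
  rw [lact_proj, reassoc_of% h, reassoc_of% lcoact_counit]

end HopfBimodule

/-! ### The invariants of a Hopf bimodule -/

namespace Word
variable {A X Y Z : C}

lemma join_act (i : Y ⟶ X) (a : X ⊗ A ⟶ X) (p : X ⟶ Y) (Z : C) :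
    join (i ▷ A ≫ a ≫ p) Z = i ▷ (A ⊗ Z) ≫ join a Z ≫ p ▷ Z := by
  simp only [join]
  monoidal

lemma fork_coact (i : Y ⟶ X) (a : X ⟶ X ⊗ A) (p : X ⟶ Y) (Z : C) :
    fork (i ≫ a ≫ p ▷ A) Z = i ▷ Z ≫ fork a Z ≫ p ▷ (A ⊗ Z) := by
  simp only [fork]
  monoidal

lemma act_hom_iff {a : X ⊗ A ⟶ X} {b : Y ⊗ A ⟶ Y} {f : X ⟶ Y} :
    a ≫ f = f ▷ A ≫ b ↔ ∀ Z, join a Z ≫ f ▷ Z = f ▷ (A ⊗ Z) ≫ join b Z := by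
  rw [← forall_whiskerRight]
  refine forall_congr' fun Z => ?_
  rw [← cancel_epi (α_ _ _ _).inv]
  refine Eq.congr ?_ ?_ <;> simp only [join] <;> monoidal

lemma coact_hom_iff {a : X ⟶ X ⊗ A} {b : Y ⟶ Y ⊗ A} {f : X ⟶ Y} :
    a ≫ f ▷ A = f ≫ b ↔ ∀ Z, fork a Z ≫ f ▷ (A ⊗ Z) = f ▷ Z ≫ fork b Z := by
  rw [← forall_whiskerRight]
  refine forall_congr' fun Z => ?_
  rw [← cancel_mono (α_ _ _ _).hom]
  refine Eq.congr ?_ ?_ <;> simp only [fork] <;> monoidal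

end Word

namespace HopfBimodule
variable {H : C} [HopfObj H] (M : HopfBimodule H)

/-- Replacing `m` by `Π(m)` does not change `Π(m · h)`. -/
lemma proj_ract (Z : C) :
    proj M ▷ (H ⊗ Z) ≫ join M.ract Z ≫ proj M ▷ Z = join M.ract Z ≫ proj M ▷ Z := by
  have h := fun Z => antipode_cap (H := H) Z
  nth_rw 1 [proj_whiskerRight]
  simp only [Category.assoc]
  rw [reassoc_of% join_lact_ract, lact_proj, ← reassoc_of% cap_exchange, reassoc_of% h,
    reassoc_of% lcoact_counit]

section Splitting

variable {M} {I : C} {i : I ⟶ M.X} {p : M.X ⟶ I}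

lemma incl_lcoact (hi : i ≫ proj M = i) (Z : C) :
    i ▷ Z ≫ fork M.lcoact Z = i ▷ Z ≫ cup η[H] (M.X ⊗ Z) := by
  rw [← hi, comp_whiskerRight, Category.assoc, Category.assoc, proj_lcoact]

lemma incl_ract_lcoact (hi : i ≫ proj M = i) (Z : C) :
    i ▷ (H ⊗ Z) ≫ join M.ract Z ≫ fork M.lcoact Z =
      I ◁ fork Δ[H] Z ≫ i ▷ (H ⊗ (H ⊗ Z)) ≫ cross M.X H (H ⊗ Z) ≫ H ◁ join M.ract Z := by
  rw [join_ract_fork_lcoact, reassoc_of% whiskerRight_exchange, reassoc_of% incl_lcoact hi,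
    reassoc_of% cup_exchange, reassoc_of% cup_exchange, cup_join_mul_left, Category.comp_id]

/-- On the image of `Π` the right action is `m · h = h₁ · Π(m · h₂)` up to braidings. -/
lemma incl_ract (hi : i ≫ proj M = i) (Z : C) :
    i ▷ (H ⊗ Z) ≫ join M.ract Z =
      I ◁ fork Δ[H] Z ≫ i ▷ (H ⊗ (H ⊗ Z)) ≫ cross M.X H (H ⊗ Z) ≫ H ◁ join M.ract Z ≫
        H ◁ proj M ▷ Z ≫ join M.lact Z := by
  rw [← reassoc_of% incl_ract_lcoact hi, lcoact_proj_lact, Category.comp_id]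

/-- The right coaction preserves the image of `Π`. -/
lemma incl_rcoact (hi : i ≫ proj M = i) (Z : C) :
    i ▷ Z ≫ fork M.rcoact Z ≫ proj M ▷ (H ⊗ Z) = i ▷ Z ≫ fork M.rcoact Z := by
  rw [proj_whiskerRight, ← reassoc_of% fork_lcoact_rcoact, reassoc_of% incl_lcoact hi,
    reassoc_of% cup_exchange, reassoc_of% cup_antipode, one_lact, Category.comp_id]

/-- The right action and coaction induced on an image of `Π` make it a crossed module. The splitting
is an arbitrary one, so that the lemma also applies to explicit splittings for special `M`. -/
lemma isCrossedModule_of_splitting (hip : i ≫ p = 𝟙 I) (hpi : p ≫ i = proj M) :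
    IsCrossedModule H (i ▷ H ≫ M.ract ≫ p) (i ≫ M.rcoact ≫ p ▷ H) := by
  have hi : i ≫ proj M = i := by rw [← hpi, reassoc_of% hip]
  have hp : proj M ≫ p = p := by rw [← hpi, Category.assoc, hip, Category.comp_id]
  have hip' : ∀ Z, i ▷ Z ≫ p ▷ Z = 𝟙 _ := fun Z => by rw [← comp_whiskerRight, hip]; simp
  have hpi' : ∀ Z, p ▷ Z ≫ i ▷ Z = proj M ▷ Z := fun Z => by rw [← comp_whiskerRight, hpi]
  have hp' : ∀ Z, proj M ▷ Z ≫ p ▷ Z = p ▷ Z := fun Z => by rw [← comp_whiskerRight, hp]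
  have hr : ∀ Z, proj M ▷ (H ⊗ Z) ≫ join M.ract Z ≫ p ▷ Z = join M.ract Z ≫ p ▷ Z := fun Z => by
    rw [← hp', reassoc_of% proj_ract]
  have hl : ∀ Z, join M.lact Z ≫ p ▷ Z = cap ε[H] (M.X ⊗ Z) ≫ p ▷ Z := fun Z => by
    rw [← hp', reassoc_of% lact_proj]
  have hc := fun Z => incl_rcoact hi Z
  constructor
  · constructor
    · rw [cup_join_right_iff]
      intro Z
      rw [join_act, ← reassoc_of% whiskerRight_exchange, reassoc_of% one_ract, hip']
    · rw [join_join_right_iff]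
      intro Z
      simp only [join_act, Category.assoc]
      rw [reassoc_of% hpi', hr, reassoc_of% ract_ract, reassoc_of% whiskerRight_exchange]
  · constructor
    · rw [fork_cap_right_iff]
      intro Z
      simp only [fork_coact, Category.assoc]
      rw [whiskerRight_exchange, reassoc_of% rcoact_counit, hip']
    · rw [fork_fork_right_iff]
      intro Z
      simp only [fork_coact, Category.assoc]
      rw [reassoc_of% hpi', reassoc_of% hc, reassoc_of% rcoact_rcoact, whiskerRight_exchange]
  · rw [crossed_iff]
    intro Z
    simp only [join_act, fork_coact, Category.assoc, MonoidalCategory.whiskerLeft_comp]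
    -- both sides are equal to `(p ⊗ id) ∘ rcoact ∘ ract ∘ (i ⊗ id)`
    trans i ▷ (H ⊗ Z) ≫ join M.ract Z ≫ fork M.rcoact Z ≫ p ▷ (H ⊗ Z)
    · rw [reassoc_of% incl_ract hi, reassoc_of% join_lact_fork_rcoact, hl,
        ← reassoc_of% (cross_whiskerRight_left i), reassoc_of% (whisk₂₁ H (hpi' _)),
        reassoc_of% (cross_whiskerRight p), whiskerRight_exchange,
        ← reassoc_of% cap_exchange, ← reassoc_of% cap_exchange, reassoc_of% fork_comul_cap_left]
    · rw [reassoc_of% join_ract_fork_rcoact, reassoc_of% whiskerRight_exchange p,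
        reassoc_of% whiskerRight_exchange p, reassoc_of% hpi', hr,
        reassoc_of% whiskerRight_exchange i]

end Splitting

end HopfBimodule

lemma one_whiskerRight_counit (H : C) [BimonObj H] (X : C) :
    ((λ_ X).inv ≫ η[H] ▷ X) ≫ ε[H] ▷ X ≫ (λ_ X).hom = 𝟙 X := by
  rw [Category.assoc, ← comp_whiskerRight_assoc, BimonObj.one_counit]
  simp

lemma one_comul_eq (H : C) [BimonObj H] : η[H] ≫ Δ[H] = (η[H] ≫ (λ_ H).inv) ≫ η[H] ▷ H := by
  rw [BimonObj.one_comul, MonObj.tensorObj.one_def, MonoidalCategory.tensorHom_def',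
    leftUnitor_inv_naturality, Category.assoc]

/-- The action induced by `H ⊗ X` on its invariants `X` is the given one. -/
lemma diagRightAct_regular {H : C} [HopfObj H] {X : C} (a : X ⊗ H ⟶ X) :
    ((λ_ X).inv ≫ η[H] ▷ X) ▷ H ≫ diagRightAct μ[H] a ≫ ε[H] ▷ X ≫ (λ_ X).hom = a := by
  have h := diagRightAct_natural (a := μ[H]) (a' := (λ_ H).hom ≫ ε[H]) (f := ε[H]) (g := 𝟙 X)
    (b := a) (b' := a) (by simp [MonoidalCategory.tensorHom_def]) (by simp)
  rw [tensorHom_id] at h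
  rw [reassoc_of% h, diagRightAct_lambda, ← comp_whiskerRight_assoc, ← comp_whiskerRight_assoc,
    Category.assoc, one_whiskerRight_counit, id_whiskerRight, Category.id_comp]

/-- The coaction induced by `H ⊗ X` on its invariants `X` is the given one. -/
lemma diagRightCoact_regular {H : C} [HopfObj H] {X : C} (a : X ⟶ X ⊗ H) :
    ((λ_ X).inv ≫ η[H] ▷ X) ≫ diagRightCoact Δ[H] a ≫ (ε[H] ▷ X ≫ (λ_ X).hom) ▷ H = a := by
  have h := diagRightCoact_natural (a := η[H] ≫ (λ_ H).inv) (a' := Δ[H]) (f := η[H]) (g := 𝟙 X)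
    (b := a) (b' := a) (one_comul_eq H).symm (by simp)
  rw [tensorHom_id] at h
  rw [Category.assoc, ← reassoc_of% h, ← comp_whiskerRight, ← comp_whiskerRight_assoc η[H],
    BimonObj.one_counit, id_whiskerRight, Category.id_comp, diagRightCoact_lambda,
    Iso.inv_hom_id_assoc]

/-- The unit object and `V ⊗ W` are the crossed modules of invariants of the Hopf bimodules `H` and
`(H ⊗ V) ⊗ W`, split explicitly by the unit and counit of `H`. -/
instance CrossedModule.tensorClosed (H : C) [HopfObj H] : CrossedModule.TensorClosed H where
  unit := by
    have h := HopfBimodule.isCrossedModule_of_splitting (M := HopfBimodule.regular H) (i := η)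
      (p := ε) (BimonObj.one_counit H) HopfBimodule.proj_regular.symm
    convert! h using 1
    · simp [MonoidalCategory.tensorHom_def, ← comp_whiskerRight_assoc]
    · exact congrArg (η[H] ≫ ·) (ComonObj.counit_comul H).symm
  tensor V W := by
    have h := HopfBimodule.isCrossedModule_of_splitting (M := HopfBimodule.tensorCrossed
      (HopfBimodule.tensorCrossed (HopfBimodule.regular H) V) W)
      (i := ((λ_ _).inv ≫ η ▷ (V.X ⊗ W.X)) ≫ (α_ _ _ _).inv)
      (p := (α_ _ _ _).hom ≫ ε ▷ (V.X ⊗ W.X) ≫ (λ_ _).hom) ?_ ?_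
    · convert! h using 1
      · have e := diagRightAct_assoc μ[H] V.act W.act
        rw [reassoc_of% e, comp_whiskerRight_assoc, ← comp_whiskerRight_assoc (α_ _ _ _).inv,
          Iso.inv_hom_id, id_whiskerRight, Category.id_comp, diagRightAct_regular]
      · have e := diagRightCoact_assoc Δ[H] V.coact W.coact
        rw [comp_whiskerRight, reassoc_of% e, Category.assoc, Iso.inv_hom_id_assoc,
          diagRightCoact_regular]
    · simp only [Category.assoc, Iso.inv_hom_id_assoc]
      rw [← comp_whiskerRight_assoc, BimonObj.one_counit]
      simp
    · rw [HopfBimodule.proj_tensorCrossed, HopfBimodule.proj_tensorCrossed,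
        HopfBimodule.proj_regular]
      simp only [Category.assoc]
      monoidal

/-! ### Hopf bimodules are generated by their invariants -/

namespace HopfBimodule
variable {H : C} [HopfObj H]
open InvariantSplitting

variable (H) in
lemma nonempty_invariantSplitting [IsIdempotentComplete C] : Nonempty (InvariantSplitting H) := by
  choose I i p h using fun M : HopfBimodule H =>
    IsIdempotentComplete.idempotents_split M.X (proj M) (proj_proj M)
  exact ⟨⟨I, i, p, fun M => (h M).1, fun M => (h M).2⟩⟩

variable [InvariantSplitting H]

instance invariantsCrossed : InvariantsCrossed H where
  isCrossedModule M := isCrossedModule_of_splitting (incl_retr M) (retr_incl M)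

section
variable (M : HopfBimodule H)

lemma generate_whiskerRight (Z : C) : (H ◁ incl M ≫ M.lact) ▷ Z =
    (α_ _ _ _).hom ≫ H ◁ incl M ▷ Z ≫ join M.lact Z := by
  simp only [join]
  monoidal

/-- The isomorphism `lact ∘ (id ⊗ incl) : H ⊗ inv M ≅ M` of objects of `C`, with inverse
`(id ⊗ retr) ∘ lcoact`. -/
@[simps]
def generateIso : H ⊗ inv M ≅ M.X where
  hom := H ◁ incl M ≫ M.lact
  inv := M.lcoact ≫ H ◁ retr M
  hom_inv_id := by
    rw [← forall_whiskerRight]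
    intro Z
    have h : (M.lcoact ≫ H ◁ retr M) ▷ Z = fork M.lcoact Z ≫ H ◁ retr M ▷ Z ≫ (α_ _ _ _).inv := by
      simp only [fork]
      monoidal
    rw [comp_whiskerRight, generate_whiskerRight, h, id_whiskerRight]
    simp only [Category.assoc]
    have hi : incl M ▷ Z = incl M ▷ Z ≫ proj M ▷ Z := by rw [← comp_whiskerRight, incl_proj]
    have hr : retr M ▷ Z = proj M ▷ Z ≫ retr M ▷ Z := by rw [← comp_whiskerRight, proj_retr]
    have hir : incl M ▷ Z ≫ retr M ▷ Z = 𝟙 _ := by rw [← comp_whiskerRight, incl_retr]; simp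
    rw [hi, MonoidalCategory.whiskerLeft_comp, Category.assoc, reassoc_of% lact_lcoact_proj, hr,
      MonoidalCategory.whiskerLeft_comp, Category.assoc, reassoc_of% (whisk₂₂ H (lact_proj M Z)),
      reassoc_of% fork_comul_cap_right]
    simp only [← MonoidalCategory.whiskerLeft_comp_assoc]
    rw [← hr, reassoc_of% hi.symm, hir]
    simp
  inv_hom_id := by
    have h := (lcoact_proj_lact M (𝟙_ C))
    rw [← whiskerRight_iff, id_whiskerRight, ← h, ← retr_incl]
    simp only [fork, join]
    monoidal

lemma generateIso_act :
    inducedLeftAct μ[H] (inv M) ≫ (generateIso M).hom = H ◁ (generateIso M).hom ≫ M.lact := by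
  simp only [generateIso_hom, inducedLeftAct, Category.assoc, MonoidalCategory.whiskerLeft_comp,
    M.isHopfBimodule.isLeftModule.act_act]
  rw [← whisker_exchange_assoc, associator_inv_naturality_right_assoc]

lemma generateIso_lcoact :
    inducedLeftCoact Δ[H] (inv M) ≫ H ◁ (generateIso M).hom = (generateIso M).hom ≫ M.lcoact := by
  -- compatibility with the coactions is immediate for the inverse `(id ⊗ retr) ∘ lcoact`
  have h : (generateIso M).inv ≫ inducedLeftCoact Δ[H] (inv M) =
      M.lcoact ≫ H ◁ (generateIso M).inv := by
    simp only [generateIso_inv, inducedLeftCoact, Category.assoc, MonoidalCategory.whiskerLeft_comp]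
    rw [reassoc_of% M.isHopfBimodule.isLeftComodule.coact_coact, whisker_exchange_assoc,
      associator_naturality_right]
  rw [← Iso.inv_comp_eq, reassoc_of% h, ← MonoidalCategory.whiskerLeft_comp, Iso.inv_hom_id,
    MonoidalCategory.whiskerLeft_id, Category.comp_id]

lemma generateIso_ract :
    diagRightAct μ[H] (invAct M) ≫ (generateIso M).hom = (generateIso M).hom ▷ H ≫ M.ract := by
  rw [act_hom_iff]
  intro Z
  have hir : ∀ Z, retr M ▷ Z ≫ incl M ▷ Z = proj M ▷ Z := fun Z => by
    rw [← comp_whiskerRight, retr_incl]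
  have hi := congrArg (H ◁ ·) (incl_ract (incl_proj M) Z)
  simp only [MonoidalCategory.whiskerLeft_comp] at hi
  rw [← cancel_epi (α_ _ _ _).inv]
  simp only [generateIso_hom, generate_whiskerRight, join_diagRightAct, invAct, join_act,
    Category.assoc, Iso.inv_hom_id_assoc, MonoidalCategory.whiskerLeft_comp]
  rw [reassoc_of% (join_exchange μ[H]), ← lact_lact,
    reassoc_of% (whisk₂₁ H (whisk₂₁ H (hir Z))),
    ← reassoc_of% (whisk₂₂ H (cross_whiskerRight_left (incl M))), join_lact_ract,
    reassoc_of% hi]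

lemma generateIso_rcoact :
    diagRightCoact Δ[H] (invCoact M) ≫ (generateIso M).hom ▷ H =
      (generateIso M).hom ≫ M.rcoact := by
  rw [coact_hom_iff]
  intro Z
  have hir : ∀ Z, retr M ▷ Z ≫ incl M ▷ Z = proj M ▷ Z := fun Z => by
    rw [← comp_whiskerRight, retr_incl]
  have hi := fun Z => incl_rcoact (incl_proj M) Z
  rw [← cancel_epi (α_ _ _ _).inv]
  simp only [generateIso_hom, generate_whiskerRight, fork_diagRightCoact, invCoact, fork_coact,
    Category.assoc, Iso.inv_hom_id_assoc, MonoidalCategory.whiskerLeft_comp]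
  rw [join_lact_fork_rcoact, ← reassoc_of% (whisk₂₂ H (whiskerRight_exchange (incl M) _)),
    ← reassoc_of% (whisk₂₂ H (cross_whiskerRight (incl M))), reassoc_of% (fork_exchange Δ[H]),
    reassoc_of% (whisk₂₁ H (hir _)), reassoc_of% whisk₃₂ H (hi Z)]

end

instance invariantsGenerate : InvariantsGenerate H where
  exists_iso M := ⟨isoMk (generateIso M) (generateIso_act M) (generateIso_ract M)
    (generateIso_lcoact M) (generateIso_rcoact M), rfl⟩

end HopfBimodule

/-! ### The braiding of crossed modules -/

namespace CrossedModule
section Bialgebra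
variable {B : C} [BimonObj B] (U V W : CrossedModule B)

lemma one_act (Z : C) : V.X ◁ cup η[B] Z ≫ join V.act Z = 𝟙 _ :=
  cup_join_right_iff.1 V.isCrossedModule.isRightModule.one_act Z

lemma act_act (Z : C) : join V.act (B ⊗ Z) ≫ join V.act Z = V.X ◁ join μ[B] Z ≫ join V.act Z :=
  join_join_right_iff.1 V.isCrossedModule.isRightModule.act_act Z

lemma coact_coact (Z : C) :
    fork V.coact Z ≫ fork V.coact (B ⊗ Z) = fork V.coact Z ≫ V.X ◁ fork Δ[B] Z :=
  fork_fork_right_iff.1 V.isCrossedModule.isRightComodule.coact_coact Z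

lemma coact_counit (Z : C) : fork V.coact Z ≫ V.X ◁ cap ε[B] Z = 𝟙 _ :=
  fork_cap_right_iff.1 V.isCrossedModule.isRightComodule.coact_counit Z

lemma crossed (Z : C) :
    V.X ◁ fork Δ[B] Z ≫ cross V.X B (B ⊗ Z) ≫ B ◁ join V.act Z ≫ B ◁ fork V.coact Z ≫
        cross B V.X (B ⊗ Z) ≫ V.X ◁ join μ[B] Z =
      V.X ◁ fork Δ[B] Z ≫ fork V.coact (B ⊗ (B ⊗ Z)) ≫ V.X ◁ cross B B (B ⊗ Z) ≫
        V.X ◁ B ◁ join μ[B] Z ≫ join V.act (B ⊗ Z) :=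
  crossed_iff.1 V.isCrossedModule.compatibility Z

lemma braidHom_whiskerRight (Z : C) : braidHom V W ▷ Z = (α_ _ _ _).hom ≫
    V.X ◁ fork W.coact Z ≫ cross V.X W.X (B ⊗ Z) ≫ W.X ◁ join V.act Z ≫ (α_ _ _ _).inv := by
  simp only [braidHom, fork, join, cross]
  monoidal

/-- The braiding commutes with the diagonal actions, by the compatibility condition of `W`. -/
lemma braidHom_act : diagRightAct V.act W.act ≫ braidHom V W =
    braidHom V W ▷ B ≫ diagRightAct W.act V.act := by
  rw [act_hom_iff]
  intro Z
  have hW := congrArg (V.X ◁ ·) (crossed W Z)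
  simp only [MonoidalCategory.whiskerLeft_comp] at hW
  rw [← cancel_epi (α_ _ _ _).inv, ← cancel_mono (α_ _ _ _).hom]
  simp only [braidHom_whiskerRight, join_diagRightAct, Category.assoc, Iso.inv_hom_id_assoc,
    Iso.inv_hom_id, Category.comp_id]
  rw [reassoc_of% join_exchange V.act, reassoc_of% join_cross_left V.act, whisk₂₂ W.X (act_act V Z),
    reassoc_of% (cross_exchange (join μ[B] Z)), reassoc_of% hW, reassoc_of% join_cross W.act,
    join_exchange W.act, ← reassoc_of% (cross_exchange (B ◁ join μ[B] Z)),
    ← reassoc_of% (whisk₂₂ W.X (cross_exchange (join μ[B] Z))),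
    ← reassoc_of% (whisk₂₂ W.X (whisk₂₂ B (act_act V Z)))]
  symm
  rw [reassoc_of% (whisk₂₂ W.X (join_exchange V.act _)),
    reassoc_of% (whisk₂₃ W.X (join_cross_left V.act)),
    reassoc_of% cross_exchange, reassoc_of% (whisk₂₂ V.X (fork_exchange W.coact _)),
    reassoc_of% cross_exchange]

/-- The braiding commutes with the diagonal coactions, by the compatibility condition of `V`. -/
lemma braidHom_coact : diagRightCoact V.coact W.coact ≫ braidHom V W ▷ B =
    braidHom V W ≫ diagRightCoact W.coact V.coact := by
  rw [coact_hom_iff]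
  intro Z
  have hV := congrArg (W.X ◁ ·) (crossed V Z)
  simp only [MonoidalCategory.whiskerLeft_comp] at hV
  rw [← cancel_epi (α_ _ _ _).inv, ← cancel_mono (α_ _ _ _).hom]
  simp only [braidHom_whiskerRight, fork_diagRightCoact, Category.assoc, Iso.inv_hom_id_assoc,
    Iso.inv_hom_id, Category.comp_id]
  symm
  rw [← reassoc_of% (fork_exchange W.coact (fork V.coact Z)),
    ← reassoc_of% (fork_exchange W.coact (join V.act Z)),
    reassoc_of% (fork_cross (W := V.X) W.coact).symm, reassoc_of% (whisk₂₂ V.X (coact_coact W Z)),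
    ← reassoc_of% (cross_exchange (fork Δ[B] Z)), hV,
    reassoc_of% (cross_exchange (fork Δ[B] Z)), reassoc_of% (fork_cross_left V.coact).symm,
    reassoc_of% cross_exchange, reassoc_of% cross_exchange]
  symm
  rw [← reassoc_of% (whisk₂₂ V.X (fork_exchange W.coact (join μ[B] Z))),
    reassoc_of% (whisk₂₃ V.X (fork_cross W.coact).symm), reassoc_of% fork_exchange V.coact,
    reassoc_of% (whisk₂₂ V.X (coact_coact W Z))]

variable {U V W}

lemma braidHom_naturality {V V' W W' : CrossedModule B} (f : V ⟶ V') (g : W ⟶ W') :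
    (f.hom ⊗ₘ g.hom) ≫ braidHom V' W' = braidHom V W ≫ (g.hom ⊗ₘ f.hom) := by
  rw [← forall_whiskerRight]
  intro Z
  have hf := fun Z => act_hom_iff.1 f.act_hom Z
  have hg := fun Z => coact_hom_iff.1 g.coact_hom Z
  have e1 : ∀ Z, (f.hom ⊗ₘ g.hom) ▷ Z = (α_ _ _ _).hom ≫ f.hom ▷ (W.X ⊗ Z) ≫ V'.X ◁ g.hom ▷ Z ≫
      (α_ _ _ _).inv := by intro Z; rw [MonoidalCategory.tensorHom_def]; monoidal
  have e2 : ∀ Z, (g.hom ⊗ₘ f.hom) ▷ Z = (α_ _ _ _).hom ≫ g.hom ▷ (V.X ⊗ Z) ≫ W'.X ◁ f.hom ▷ Z ≫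
      (α_ _ _ _).inv := by intro Z; rw [MonoidalCategory.tensorHom_def]; monoidal
  rw [comp_whiskerRight, comp_whiskerRight, braidHom_whiskerRight, braidHom_whiskerRight, e1, e2,
    ← cancel_epi (α_ _ _ _).inv, ← cancel_mono (α_ _ _ _).hom]
  simp only [Category.assoc, Iso.inv_hom_id_assoc, Iso.inv_hom_id, Category.comp_id]
  rw [← reassoc_of% (whisk₂₂ V'.X (hg Z)), reassoc_of% (cross_whiskerRight g.hom),
    reassoc_of% (whiskerRight_exchange f.hom), reassoc_of% (cross_whiskerRight_left f.hom),
    whiskerRight_exchange g.hom, ← reassoc_of% (whisk₂₂ W.X (hf Z)), whiskerRight_exchange]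

variable (U V W)

/-- The associativity of the action of `U` is what makes the hexagon hold. -/
lemma braidHom_hexagon_forward [TensorClosed B] :
    (α_ U.X V.X W.X).hom ≫ braidHom U (V ⊗ W) ≫ (α_ V.X W.X U.X).hom =
      braidHom U V ▷ W.X ≫ (α_ V.X U.X W.X).hom ≫ V.X ◁ braidHom U W := by
  rw [← forall_whiskerRight]
  intro Z
  have h : braidHom U (V ⊗ W) ▷ Z = (α_ U.X (V.X ⊗ W.X) Z).hom ≫
      U.X ◁ fork (diagRightCoact V.coact W.coact) Z ≫ cross U.X (V.X ⊗ W.X) (B ⊗ Z) ≫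
        (V.X ⊗ W.X) ◁ join U.act Z ≫ (α_ (V.X ⊗ W.X) U.X Z).inv :=
    braidHom_whiskerRight U (V ⊗ W) Z
  have e : (V.X ◁ braidHom U W) ▷ Z =
      (α_ _ _ _).hom ≫ V.X ◁ braidHom U W ▷ Z ≫ (α_ _ _ _).inv := by
    monoidal
  have e' : braidHom U V ▷ W.X ▷ Z =
      (α_ _ _ _).hom ≫ braidHom U V ▷ (W.X ⊗ Z) ≫ (α_ _ _ _).inv := by
    monoidal
  rw [comp_whiskerRight, comp_whiskerRight, comp_whiskerRight, comp_whiskerRight, h, e, e',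
    braidHom_whiskerRight, braidHom_whiskerRight, fork_diagRightCoact, cross_tensor_right]
  trans ((α_ _ _ _).hom ≫ (α_ U.X V.X (W.X ⊗ Z)).hom) ≫ (U.X ◁ V.X ◁ fork W.coact Z ≫
    U.X ◁ fork V.coact (W.X ⊗ (B ⊗ Z)) ≫ U.X ◁ V.X ◁ cross B W.X (B ⊗ Z) ≫
    U.X ◁ V.X ◁ W.X ◁ join μ[B] Z ≫ cross U.X V.X (W.X ⊗ (B ⊗ Z)) ≫
    V.X ◁ cross U.X W.X (B ⊗ Z) ≫ V.X ◁ W.X ◁ join U.act Z) ≫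
      (α_ V.X W.X (U.X ⊗ Z)).inv ≫ (α_ (V.X ⊗ W.X) U.X Z).inv ≫ (α_ V.X W.X U.X).hom ▷ Z
  · monoidal
  have key : U.X ◁ V.X ◁ fork W.coact Z ≫ U.X ◁ fork V.coact (W.X ⊗ (B ⊗ Z)) ≫
      U.X ◁ V.X ◁ cross B W.X (B ⊗ Z) ≫ U.X ◁ V.X ◁ W.X ◁ join μ[B] Z ≫
      cross U.X V.X (W.X ⊗ (B ⊗ Z)) ≫ V.X ◁ cross U.X W.X (B ⊗ Z) ≫ V.X ◁ W.X ◁ join U.act Z =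
      U.X ◁ fork V.coact (W.X ⊗ Z) ≫ cross U.X V.X (B ⊗ (W.X ⊗ Z)) ≫ V.X ◁ join U.act (W.X ⊗ Z) ≫
      V.X ◁ U.X ◁ fork W.coact Z ≫ V.X ◁ cross U.X W.X (B ⊗ Z) ≫ V.X ◁ W.X ◁ join U.act Z := by
    rw [reassoc_of% (whisk₂₂ V.X (join_exchange U.act (fork W.coact Z))),
      reassoc_of% (whisk₂₃ V.X (join_cross_left U.act)), whisk₂₂ V.X (whisk₂₂ W.X (act_act U Z)),
      reassoc_of% (whisk₂₂ V.X (cross_exchange (join μ[B] Z))), reassoc_of% cross_exchange,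
      reassoc_of% cross_exchange, reassoc_of% cross_exchange,
      reassoc_of% (whisk₂₂ U.X (fork_exchange V.coact (fork W.coact Z)))]
  rw [key]
  monoidal

/-- The coassociativity of the coaction of `W` is what makes the hexagon hold. -/
lemma braidHom_hexagon_reverse [TensorClosed B] :
    (α_ U.X V.X W.X).inv ≫ braidHom (U ⊗ V) W ≫ (α_ W.X U.X V.X).inv =
      U.X ◁ braidHom V W ≫ (α_ U.X W.X V.X).inv ≫ braidHom U W ▷ V.X := by
  rw [← forall_whiskerRight]
  intro Z
  have h : braidHom (U ⊗ V) W ▷ Z = (α_ (U.X ⊗ V.X) W.X Z).hom ≫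
      (U.X ⊗ V.X) ◁ fork W.coact Z ≫ cross (U.X ⊗ V.X) W.X (B ⊗ Z) ≫
        W.X ◁ join (diagRightAct U.act V.act) Z ≫ (α_ W.X (U.X ⊗ V.X) Z).inv :=
    braidHom_whiskerRight (U ⊗ V) W Z
  have e : (U.X ◁ braidHom V W) ▷ Z =
      (α_ _ _ _).hom ≫ U.X ◁ braidHom V W ▷ Z ≫ (α_ _ _ _).inv := by
    monoidal
  have e' : braidHom U W ▷ V.X ▷ Z =
      (α_ _ _ _).hom ≫ braidHom U W ▷ (V.X ⊗ Z) ≫ (α_ _ _ _).inv := by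
    monoidal
  rw [comp_whiskerRight, comp_whiskerRight, comp_whiskerRight, comp_whiskerRight, h, e, e',
    braidHom_whiskerRight, braidHom_whiskerRight, join_diagRightAct, cross_tensor_left]
  trans ((α_ U.X (V.X ⊗ W.X) Z).hom ≫ U.X ◁ (α_ V.X W.X Z).hom) ≫ (U.X ◁ V.X ◁ fork W.coact Z ≫
    U.X ◁ cross V.X W.X (B ⊗ Z) ≫ cross U.X W.X (V.X ⊗ (B ⊗ Z)) ≫
    W.X ◁ U.X ◁ V.X ◁ fork Δ[B] Z ≫ W.X ◁ U.X ◁ cross V.X B (B ⊗ Z) ≫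
    W.X ◁ U.X ◁ B ◁ join V.act Z ≫ W.X ◁ join U.act (V.X ⊗ Z)) ≫
      (α_ W.X U.X (V.X ⊗ Z)).inv ≫ (α_ (W.X ⊗ U.X) V.X Z).inv
  · monoidal
  have key : U.X ◁ V.X ◁ fork W.coact Z ≫ U.X ◁ cross V.X W.X (B ⊗ Z) ≫
      cross U.X W.X (V.X ⊗ (B ⊗ Z)) ≫ W.X ◁ U.X ◁ V.X ◁ fork Δ[B] Z ≫
      W.X ◁ U.X ◁ cross V.X B (B ⊗ Z) ≫ W.X ◁ U.X ◁ B ◁ join V.act Z ≫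
      W.X ◁ join U.act (V.X ⊗ Z) =
      U.X ◁ V.X ◁ fork W.coact Z ≫ U.X ◁ cross V.X W.X (B ⊗ Z) ≫ U.X ◁ W.X ◁ join V.act Z ≫
      U.X ◁ fork W.coact (V.X ⊗ Z) ≫ cross U.X W.X (B ⊗ (V.X ⊗ Z)) ≫
      W.X ◁ join U.act (V.X ⊗ Z) := by
    rw [← reassoc_of% (whisk₂₂ U.X (fork_exchange W.coact (join V.act Z))),
      ← reassoc_of% (whisk₃₂ U.X (fork_cross (W := V.X) W.coact)),
      reassoc_of% (whisk₂₂ U.X (whisk₂₂ V.X (coact_coact W Z))),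
      reassoc_of% (whisk₂₂ U.X (cross_exchange (X := V.X) (fork Δ[B] Z))).symm,
      ← reassoc_of% cross_exchange, ← reassoc_of% cross_exchange, ← reassoc_of% cross_exchange]
  rw [key]
  monoidal

end Bialgebra

section Hopf
variable {H : C} [HopfObj H]

instance (X Y Z : C) : IsIso (cross X Y Z) := by
  unfold cross
  infer_instance

lemma inv_cross (X Y Z : C) : inv (cross X Y Z) =
    (α_ _ _ _).inv ≫ (β_ X Y).inv ▷ Z ≫ (α_ _ _ _).hom := by
  refine IsIso.inv_eq_of_hom_inv_id ?_
  simp [cross]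

variable (V W : CrossedModule H)

/-- The right action of a crossed module, turned into a morphism `H ⊗ V ⟶ V` by the inverse
braiding, on the first factors of `H ⊗ (V ⊗ Z)`. -/
noncomputable def swapAct (Z : C) : H ⊗ (V.X ⊗ Z) ⟶ V.X ⊗ Z :=
  inv (cross V.X H Z) ≫ join V.act Z

/-- `swapAct` is a left action for the multiplication composed with the inverse braiding. -/
lemma swapAct_swapAct (Z : C) : H ◁ swapAct V Z ≫ swapAct V Z =
    inv (cross H H (V.X ⊗ Z)) ≫ join μ[H] (V.X ⊗ Z) ≫ swapAct V Z := by
  rw [← cancel_epi (V.X ◁ cross H H Z ≫ cross V.X H (H ⊗ Z) ≫ H ◁ cross V.X H Z)]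
  have h := join_cross (W := V.X) (Z := Z) μ[H]
  simp only [swapAct, MonoidalCategory.whiskerLeft_comp, Category.assoc]
  rw [reassoc_of% (whisk₂₀ H (IsIso.hom_inv_id (cross V.X H Z))),
    ← reassoc_of% join_cross_left V.act, reassoc_of% Word.cross_cross, IsIso.hom_inv_id_assoc,
    IsIso.hom_inv_id_assoc, ← reassoc_of% h, IsIso.hom_inv_id_assoc, act_act]

lemma cup_swapAct (Z : C) : cup η[H] (V.X ⊗ Z) ≫ swapAct V Z = 𝟙 _ := by
  rw [swapAct, ← cup_cross, Category.assoc, IsIso.hom_inv_id_assoc, one_act]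

/-- The braiding as the braiding of `C` followed by the coaction of `W` and `swapAct`. -/
lemma braidHom_eq_swapAct (Z : C) : braidHom V W ▷ Z = (α_ _ _ _).hom ≫
    cross V.X W.X Z ≫ fork W.coact (V.X ⊗ Z) ≫ W.X ◁ swapAct V Z ≫ (α_ _ _ _).inv := by
  have h := fork_cross (W := V.X) (Z := Z) W.coact
  rw [braidHom_whiskerRight, ← reassoc_of% h, swapAct, MonoidalCategory.whiskerLeft_comp,
    Category.assoc, reassoc_of% (whisk₂₀ W.X (IsIso.hom_inv_id (cross V.X H Z)))]

variable [IsIso 𝒮[H]]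

/-- The inverse of `S` satisfies the left antipode identity for the multiplication composed with the
inverse braiding. -/
lemma fork_inv_antipode_left (Z : C) :
    fork Δ[H] Z ≫ inv 𝒮[H] ▷ (H ⊗ Z) ≫ inv (cross H H Z) ≫ join μ[H] Z =
      cap ε[H] Z ≫ cup η[H] Z := by
  rw [← cancel_mono (𝒮[H] ▷ Z)]
  simp only [Category.assoc]
  have h : 𝒮[H] ▷ (H ⊗ Z) ≫ cross H H Z = cross H H Z ≫ H ◁ 𝒮[H] ▷ Z :=
    cross_whiskerRight_left 𝒮[H]
  have h' := cross_whiskerRight (W := H) (Z := Z) 𝒮[H]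
  rw [join_antipode, cup_antipode, reassoc_of% h, reassoc_of% h']
  simp only [IsIso.inv_hom_id_assoc]
  rw [← comp_whiskerRight_assoc, IsIso.inv_hom_id,
    id_whiskerRight, Category.id_comp, fork_antipode_right]

/-- The inverse of `S` satisfies the right antipode identity for the multiplication composed with
the inverse braiding. -/
lemma fork_inv_antipode_right (Z : C) :
    fork Δ[H] Z ≫ H ◁ inv 𝒮[H] ▷ Z ≫ inv (cross H H Z) ≫ join μ[H] Z =
      cap ε[H] Z ≫ cup η[H] Z := by
  rw [← cancel_mono (𝒮[H] ▷ Z)]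
  simp only [Category.assoc]
  have h : 𝒮[H] ▷ (H ⊗ Z) ≫ cross H H Z = cross H H Z ≫ H ◁ 𝒮[H] ▷ Z :=
    cross_whiskerRight_left 𝒮[H]
  have h' := cross_whiskerRight (W := H) (Z := Z) 𝒮[H]
  have h'' : H ◁ inv 𝒮[H] ▷ Z ≫ H ◁ 𝒮[H] ▷ Z = 𝟙 _ :=
    whisk₂₀ H (by rw [← comp_whiskerRight, IsIso.inv_hom_id, id_whiskerRight])
  rw [join_antipode, cup_antipode, reassoc_of% h, reassoc_of% h']
  simp only [IsIso.inv_hom_id_assoc]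
  rw [← reassoc_of% whiskerRight_exchange, reassoc_of% h'', fork_antipode_left]

lemma fork_swapAct_left (Z : C) : fork Δ[H] (V.X ⊗ Z) ≫ H ◁ swapAct V Z ≫
    inv 𝒮[H] ▷ (V.X ⊗ Z) ≫ swapAct V Z = cap ε[H] (V.X ⊗ Z) := by
  rw [← reassoc_of% whiskerRight_exchange, swapAct_swapAct, reassoc_of% fork_inv_antipode_left,
    cup_swapAct, Category.comp_id]

lemma fork_swapAct_right (Z : C) : fork Δ[H] (V.X ⊗ Z) ≫ H ◁ inv 𝒮[H] ▷ (V.X ⊗ Z) ≫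
    H ◁ swapAct V Z ≫ swapAct V Z = cap ε[H] (V.X ⊗ Z) := by
  rw [swapAct_swapAct, reassoc_of% fork_inv_antipode_right, cup_swapAct, Category.comp_id]

/-- The inverse of `braidHom V W`: the coaction of `W` followed by `S⁻¹` and the action of `V`. -/
noncomputable def braidInv : W.X ⊗ V.X ⟶ V.X ⊗ W.X :=
  W.coact ▷ V.X ≫ (α_ W.X H V.X).hom ≫ W.X ◁ (inv 𝒮[H] ▷ V.X ≫ (β_ V.X H).inv ≫ V.act) ≫
    (β_ V.X W.X).inv

lemma braidInv_whiskerRight (Z : C) : braidInv V W ▷ Z = (α_ _ _ _).hom ≫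
    fork W.coact (V.X ⊗ Z) ≫ W.X ◁ inv 𝒮[H] ▷ (V.X ⊗ Z) ≫ W.X ◁ swapAct V Z ≫
    inv (cross V.X W.X Z) ≫ (α_ _ _ _).inv := by
  simp only [braidInv, swapAct, inv_cross, fork, join]
  monoidal

/-- The braiding of crossed modules as an isomorphism of `C`. -/
noncomputable def braidIso : V.X ⊗ W.X ≅ W.X ⊗ V.X where
  hom := braidHom V W
  inv := braidInv V W
  hom_inv_id := by
    rw [← forall_whiskerRight]
    intro Z
    rw [comp_whiskerRight, braidHom_eq_swapAct, braidInv_whiskerRight]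
    have h := congrArg (W.X ◁ ·) (fork_swapAct_left V Z)
    simp only [MonoidalCategory.whiskerLeft_comp] at h
    simp only [Category.assoc, Iso.inv_hom_id_assoc]
    rw [← reassoc_of% fork_exchange, reassoc_of% coact_coact, reassoc_of% h,
      reassoc_of% coact_counit]
    simp
  inv_hom_id := by
    rw [← forall_whiskerRight]
    intro Z
    rw [comp_whiskerRight, braidHom_eq_swapAct, braidInv_whiskerRight]
    have h := congrArg (W.X ◁ ·) (fork_swapAct_right V Z)
    simp only [MonoidalCategory.whiskerLeft_comp] at h
    simp only [Category.assoc, Iso.inv_hom_id_assoc, IsIso.inv_hom_id_assoc]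
    rw [← reassoc_of% fork_exchange, ← reassoc_of% fork_exchange, reassoc_of% coact_coact,
      reassoc_of% h, reassoc_of% coact_counit]
    simp

/-- The braided monoidal category of crossed modules. -/
noncomputable instance : BraidedCategory (CrossedModule H) where
  braiding V W := isoMk (braidIso V W) (braidHom_act V W) (braidHom_coact V W)
  braiding_naturality_right X _ _ f := by
    have h := braidHom_naturality (𝟙 X) f
    rw [id_hom, id_tensorHom, tensorHom_id] at h
    ext
    simp only [comp_hom, whiskerLeft_hom, whiskerRight_hom]
    exact h
  braiding_naturality_left f Z := by
    have h := braidHom_naturality f (𝟙 Z)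
    rw [id_hom, id_tensorHom, tensorHom_id] at h
    ext
    simp only [comp_hom, whiskerLeft_hom, whiskerRight_hom]
    exact h
  hexagon_forward U V W := by
    ext
    simp only [comp_hom, whiskerLeft_hom, whiskerRight_hom]
    exact braidHom_hexagon_forward U V W
  hexagon_reverse U V W := by
    ext
    simp only [comp_hom, whiskerLeft_hom, whiskerRight_hom]
    exact braidHom_hexagon_reverse U V W

lemma braiding_hom_hom : (β_ V W).hom.hom = braidHom V W := rfl

end Hopf
end CrossedModule

/-! ### The equivalence of braided monoidal categories -/

namespace HopfBimodule
variable {H : C} [HopfObj H] [InvariantSplitting H]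
open InvariantSplitting

lemma invTensorIso_unit (M : HopfBimodule H) :
    (invTensorIso M (𝟙_ (CrossedModule H))).hom ≫ invObjMap (tensorCrossedUnit M).hom =
      (ρ_ (invObj M)).hom := by
  ext
  have h := retr_invMap (tensorCrossedUnit M).hom
  change (incl M ▷ 𝟙_ C ≫ retr (tensorCrossed M (𝟙_ (CrossedModule H)))) ≫
    invMap (tensorCrossedUnit M).hom = (ρ_ (inv M)).hom
  rw [Category.assoc, h]
  change incl M ▷ 𝟙_ C ≫ (ρ_ M.X).hom ≫ retr M = _
  rw [rightUnitor_naturality_assoc, incl_retr, Category.comp_id]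

/-- Compatibility of `invTensorIso` with the right unitor of Hopf bimodules. -/
lemma invTensorIso_rho (M : HopfBimodule H) :
    (𝟙 (invObj M) ⊗ₘ invRegularIso.inv) ≫ (invTensorIso M (invObj (regular H))).hom ≫
      invObjMap (ρ_ M).hom = (ρ_ (invObj M)).hom := by
  have e : (ρ_ M).hom = tensorCrossedMap (𝟙 M) invRegularIso.hom ≫ (tensorCrossedUnit M).hom := rfl
  have h := invTensorIso_natural (𝟙 M) (invRegularIso (H := H)).hom
  rw [invObjMap_id] at h
  rw [e, ← invObjMap_comp, ← reassoc_of% h, tensorHom_comp_tensorHom_assoc, Iso.inv_hom_id,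
    Category.comp_id, id_tensorHom_id, Category.id_comp, invTensorIso_unit]

/-- Compatibility of `invTensorIso` with the associator of Hopf bimodules. -/
lemma invTensorIso_invTensorIso (L M N : HopfBimodule H) :
    ((invTensorIso L (invObj M)).hom ⊗ₘ 𝟙 (invObj N)) ≫
        (invTensorIso (tensorCrossed L (invObj M)) (invObj N)).hom ≫
        invObjMap ((tensorCrossedAssoc L (invObj M) (invObj N)).hom ≫
          tensorCrossedMap (𝟙 L) (invTensorIso M (invObj N)).hom) =
      (α_ (invObj L) (invObj M) (invObj N)).hom ≫
        (𝟙 (invObj L) ⊗ₘ (invTensorIso M (invObj N)).hom) ≫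
        (invTensorIso L (invObj (tensorCrossed M (invObj N)))).hom := by
  have h := invTensorIso_natural (𝟙 L) (invTensorIso M (invObj N)).hom
  rw [invObjMap_id] at h
  rw [← invObjMap_comp, reassoc_of% invTensorIso_assoc L (invObj M) (invObj N), h]

/-- The functor of invariants is strong monoidal. -/
noncomputable instance invariantsMonoidal : (invariants H).Monoidal :=
  Functor.CoreMonoidal.toMonoidal
    { εIso := invRegularIso.symm
      μIso M N := invTensorIso M (invObj N)
      μIso_hom_natural_left f N := (invTensorIso_natural f (𝟙 (invObj N)))
      μIso_hom_natural_right {_ _} M f := by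
        have h := invTensorIso_natural (𝟙 M) (invObjMap f)
        rw [invObjMap_id] at h
        exact h
      associativity := invTensorIso_invTensorIso
      left_unitality M := by
        have h := invTensorIso_regular M
        change _ = (invRegularIso.inv ⊗ₘ 𝟙 (invObj M)) ≫ (invTensorIso (regular H) (invObj M)).hom ≫
          invObjMap (regularTensorIso M).hom
        rw [h, tensorHom_comp_tensorHom_assoc, Iso.inv_hom_id, Category.comp_id, id_tensorHom_id,
          Category.id_comp]
        rfl
      right_unitality M := (invTensorIso_rho M).symm }

section
variable (M N : HopfBimodule H)

lemma braidHom_whiskerRight (Z : C) : braidHom M N ▷ Z = (α_ _ _ _).hom ≫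
    M.X ◁ incl N ▷ Z ≫ M.X ◁ fork N.rcoact Z ≫ fork M.lcoact (N.X ⊗ (H ⊗ Z)) ≫
      H ◁ cross M.X N.X (H ⊗ Z) ≫ H ◁ N.X ◁ join M.ract Z ≫ H ◁ N.X ◁ retr M ▷ Z ≫
      join N.lact (inv M ⊗ Z) ≫ (α_ _ _ _).inv := by
  rw [braidHom, MonoidalCategory.tensorHom_def', MonoidalCategory.tensorHom_def', tensorμ]
  simp only [fork, join, cross]
  monoidal

/-- The braiding of Hopf bimodules is determined by that of the crossed modules of invariants,
through the isomorphisms `H ⊗ inv M ≅ M`. -/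
lemma braidHom_eq : braidHom M N =
    M.lcoact ▷ inv N ≫ (α_ _ _ _).hom ≫ H ◁ (retr M ▷ inv N ≫
      CrossedModule.braidHom (invObj M) (invObj N) ≫ incl N ▷ inv M) ≫
      (α_ _ _ _).inv ≫ N.lact ▷ inv M := by
  rw [← forall_whiskerRight]
  intro Z
  have hc := CrossedModule.braidHom_whiskerRight (invObj M) (invObj N) Z
  have hf : fork (invObj N).coact Z = incl N ▷ Z ≫ fork N.rcoact Z ≫ retr N ▷ (H ⊗ Z) :=
    fork_coact _ _ _ Z
  have hj : join (invObj M).act Z = incl M ▷ (H ⊗ Z) ≫ join M.ract Z ≫ retr M ▷ Z :=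
    join_act _ _ _ Z
  rw [hf, hj] at hc
  trans (α_ _ _ _).hom ≫ (fork M.lcoact (inv N ⊗ Z) ≫ H ◁ retr M ▷ (inv N ⊗ Z) ≫
    H ◁ ((α_ _ _ _).inv ≫ CrossedModule.braidHom (invObj M) (invObj N) ▷ Z ≫ (α_ _ _ _).hom) ≫
    H ◁ incl N ▷ (inv M ⊗ Z) ≫ join N.lact (inv M ⊗ Z)) ≫ (α_ _ _ _).inv
  swap
  · simp only [fork, join]; monoidal
  rw [hc, braidHom_whiskerRight]
  simp only [Category.assoc, Iso.inv_hom_id_assoc, Iso.inv_hom_id, Category.comp_id,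
    MonoidalCategory.whiskerLeft_comp]
  have hM : ∀ Z, retr M ▷ Z ≫ incl M ▷ Z = proj M ▷ Z := fun Z => by
    rw [← comp_whiskerRight, retr_incl]
  have hN : ∀ Z, retr N ▷ Z ≫ incl N ▷ Z = proj N ▷ Z := fun Z => by
    rw [← comp_whiskerRight, retr_incl]
  have hr : ∀ Z, proj M ▷ (H ⊗ Z) ≫ join M.ract Z ≫ retr M ▷ Z = join M.ract Z ≫ retr M ▷ Z := by
    intro Z
    rw [← proj_retr, comp_whiskerRight, reassoc_of% proj_ract]
  have hr' := congrArg (H ◁ inv N ◁ ·) (hr Z)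
  have hi := congrArg (M.X ◁ ·) (incl_rcoact (incl_proj N) Z)
  simp only [MonoidalCategory.whiskerLeft_comp] at hr' hi
  rw [reassoc_of% (whisk₂₂ H (whiskerRight_exchange (retr M) _)),
    reassoc_of% (whisk₂₂ H (whiskerRight_exchange (retr M) _)),
    reassoc_of% (whisk₂₂ H (whiskerRight_exchange (retr M) _)),
    reassoc_of% (whisk₂₂ H (cross_whiskerRight_left (retr M))),
    reassoc_of% (whisk₂₁ H (whisk₂₁ (inv N) (hM _))), reassoc_of% hr',
    ← reassoc_of% (whisk₂₂ H (whiskerRight_exchange (incl N) _)),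
    ← reassoc_of% (whisk₂₂ H (whiskerRight_exchange (incl N) _)),
    ← reassoc_of% (whisk₂₂ H (cross_whiskerRight (incl N))),
    reassoc_of% (whisk₂₁ H (whisk₂₁ M.X (hN _))),
    reassoc_of% fork_exchange, reassoc_of% fork_exchange, reassoc_of% fork_exchange,
    reassoc_of% hi]

end

/-- The isomorphism `V ≅ inv (H ⊗ V)` obtained from `inv H ≅ 𝟙` and `inv H ⊗ V ≅ inv (H ⊗ V)`. -/
noncomputable def invSmashIso (V : CrossedModule H) : V ≅ invObj (tensorCrossed (regular H) V) :=
  (λ_ V).symm ≪≫ whiskerRightIso invRegularIso.symm V ≪≫ invTensorIso (regular H) V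

lemma invSmashIso_natural {V W : CrossedModule H} (f : V ⟶ W) :
    f ≫ (invSmashIso W).hom =
      (invSmashIso V).hom ≫ invObjMap (tensorCrossedMap (𝟙 (regular H)) f) := by
  have h := invTensorIso_natural (𝟙 (regular H)) f
  rw [invObjMap_id, id_tensorHom] at h
  simp only [invSmashIso, Iso.trans_hom, Iso.symm_hom, whiskerRightIso_hom, Category.assoc]
  rw [leftUnitor_inv_naturality_assoc, whisker_exchange_assoc, h]

variable (H)

/-- The equivalence between crossed modules and Hopf bimodules given by `H ⋉ (-)` and the functor of
invariants. -/
noncomputable def smashEquivalence : CrossedModule H ≌ HopfBimodule H :=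
  CategoryTheory.Equivalence.mk (smash H) (invariants H)
    (NatIso.ofComponents invSmashIso invSmashIso_natural)
    (NatIso.ofComponents regularTensorIso regularTensorIso_natural)

instance : (invariants H).IsEquivalence :=
  inferInstanceAs (smashEquivalence H).inverse.IsEquivalence

variable [IsIso 𝒮[H]]

/-- The braiding of Hopf bimodules pulled back from crossed modules along the invariants. -/
noncomputable instance braidedCategory : BraidedCategory (HopfBimodule H) :=
  BraidedCategory.ofFullyFaithful (invariants H)

/-- The functor of invariants is braided by construction of the braiding of Hopf bimodules. -/
noncomputable instance invariantsBraided : (invariants H).Braided where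
  braided M N := by
    change Functor.LaxMonoidal.μ (invariants H) M N ≫ (invariants H).map ((invariants H).preimage
      (Functor.OplaxMonoidal.δ (invariants H) M N ≫
      (β_ ((invariants H).obj M) ((invariants H).obj N)).hom ≫
        Functor.LaxMonoidal.μ (invariants H) N M)) = _
    rw [Functor.map_preimage, Functor.Monoidal.μ_δ_assoc]

end HopfBimodule

section
variable {D E : Type*} [Category* D] [Category* E] [MonoidalCategory D] [MonoidalCategory E]

/-- An equivalence is monoidal for the monoidal structure that its inverse inherits. -/
lemma isMonoidal_inverseMonoidal (e : D ≌ E) [e.functor.Monoidal] :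
    letI := e.inverseMonoidal
    e.IsMonoidal :=
  letI := e.inverseMonoidal
  ⟨rfl, fun _ _ => rfl⟩

/-- A monoidal quasi-inverse of a braided functor is braided. -/
lemma inverse_braided [BraidedCategory D] [BraidedCategory E] (e : D ≌ E)
    [e.functor.Braided] [e.inverse.Monoidal] [e.IsMonoidal] (X Y : E) :
    Functor.LaxMonoidal.μ e.inverse X Y ≫ e.inverse.map (β_ X Y).hom =
      (β_ (e.inverse.obj X) (e.inverse.obj Y)).hom ≫ Functor.LaxMonoidal.μ e.inverse Y X := by
  apply e.functor.map_injective
  have h := fun X Y => e.toAdjunction.map_μ_comp_counit_app_tensor X Y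
  have hn := e.toAdjunction.counit.naturality (β_ X Y).hom
  have : IsIso (e.toAdjunction.counit.app (Y ⊗ X)) := inferInstance
  rw [← cancel_mono (e.toAdjunction.counit.app (Y ⊗ X))]
  simp only [Functor.map_comp, Category.assoc]
  dsimp only [Functor.comp_map, Functor.id_map] at hn
  rw [hn, reassoc_of% h, h]
  simp
end

namespace HopfBimodule
variable (H : C) [HopfObj H] [InvariantSplitting H] [IsIso 𝒮[H]]

/-- `H ⋉ (-)` is strong monoidal as the quasi-inverse of the functor of invariants. -/
noncomputable instance smashMonoidal : (smash H).Monoidal :=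
  letI : (smashEquivalence H).symm.functor.Monoidal := invariantsMonoidal
  (smashEquivalence H).symm.inverseMonoidal

noncomputable instance : (smashEquivalence H).functor.Monoidal := smashMonoidal H
noncomputable instance : (smashEquivalence H).inverse.Braided := invariantsBraided H

instance : (smashEquivalence H).IsMonoidal :=
  letI : (smashEquivalence H).symm.functor.Monoidal := invariantsMonoidal
  letI : (smashEquivalence H).symm.inverse.Monoidal := smashMonoidal H
  haveI : (smashEquivalence H).symm.IsMonoidal := isMonoidal_inverseMonoidal _
  CategoryTheory.Equivalence.isMonoidal_symm (smashEquivalence H).symm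

noncomputable instance smashBraided : (smashEquivalence H).functor.Braided where
  braided V W := by
    let : (smashEquivalence H).symm.functor.Braided := invariantsBraided H
    let : (smashEquivalence H).symm.inverse.Monoidal := smashMonoidal H
    have : (smashEquivalence H).symm.IsMonoidal := isMonoidal_inverseMonoidal _
    exact inverse_braided (smashEquivalence H).symm V W

section
open InvariantSplitting
variable (M N : HopfBimodule H)

lemma braiding_hom_hom : (β_ M N).hom.hom = braidHom M N := by
  have h := congrArg Hom.hom (regularTensorIso_natural (β_ M N).hom)
  have hF := congrArg CrossedModule.Hom.hom (Functor.map_braiding (invariants H) M N)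
  have hF' : invMap (β_ M N).hom = (incl (tensorCrossed M (invObj N)) ≫ retr M ▷ inv N) ≫
    CrossedModule.braidHom (invObj M) (invObj N) ≫
      incl N ▷ inv M ≫ retr (tensorCrossed N (invObj M)) := hF
  have h' : (generateIso (tensorCrossed M (invObj N))).hom ≫ (β_ M N).hom.hom =
      H ◁ invMap (β_ M N).hom ≫ (generateIso (tensorCrossed N (invObj M))).hom := by
    rw [comp_hom, comp_hom, regularTensorIso_hom_hom, regularTensorIso_hom_hom] at h
    rw [← id_tensorHom]
    exact h.symm
  rw [← Iso.eq_inv_comp, hF'] at h'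
  rw [h', braidHom_eq]
  change (inducedLeftCoact M.lcoact (inv N) ≫ H ◁ retr (tensorCrossed M (invObj N))) ≫
    _ ≫ (H ◁ incl (tensorCrossed N (invObj M)) ≫ inducedLeftAct N.lact (inv M)) = _
  have hM : retr (tensorCrossed M (invObj N)) ≫ incl (tensorCrossed M (invObj N)) ≫
      retr M ▷ inv N = retr M ▷ inv N := by
    rw [reassoc_of% retr_incl, proj_tensorCrossed, ← comp_whiskerRight, proj_retr]
  have hN : incl N ▷ inv M ≫ retr (tensorCrossed N (invObj M)) ≫
      incl (tensorCrossed N (invObj M)) = incl N ▷ inv M := by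
    rw [retr_incl, proj_tensorCrossed, ← comp_whiskerRight, incl_proj]
  simp only [inducedLeftAct, inducedLeftCoact, Category.assoc]
  rw [← MonoidalCategory.whiskerLeft_comp_assoc, ← MonoidalCategory.whiskerLeft_comp_assoc]
  simp only [Category.assoc]
  rw [hN, reassoc_of% hM]
end

end HopfBimodule

end BraidedHopf

theorem mainTheorem1 {C : Type*} [Category* C] [MonoidalCategory C] [BraidedCategory C]
    [IsIdempotentComplete C] (H : C) [HopfObj H] [IsIso (𝒮 : H ⟶ H)] :
    Nonempty (HopfBimodule.InvariantSplitting H) ∧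
    ∀ [HopfBimodule.InvariantSplitting H],
      ∃ (_ : CrossedModule.TensorClosed H) (_ : HopfBimodule.TensorCrossedClosed H)
        (_ : HopfBimodule.InvariantsCrossed H) (_ : HopfBimodule.InvariantsGenerate H)
        (_ : BraidedCategory (CrossedModule H)) (_ : BraidedCategory (HopfBimodule H))
        (e : CrossedModule H ≌ HopfBimodule H)
        (_ : e.functor.Braided) (_ : e.inverse.Braided),
        (∀ V W : CrossedModule H, (β_ V W).hom.hom = CrossedModule.braidHom V W) ∧
        (∀ M N : HopfBimodule H, (β_ M N).hom.hom = HopfBimodule.braidHom M N) ∧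
        e.functor = HopfBimodule.smash H ∧
        e.inverse = HopfBimodule.invariants H ∧
        e.IsMonoidal :=
  ⟨HopfBimodule.nonempty_invariantSplitting H, fun {_} =>
    ⟨inferInstance, inferInstance, inferInstance, inferInstance, inferInstance, inferInstance,
      HopfBimodule.smashEquivalence H, inferInstance, inferInstance,
      fun V W => CrossedModule.braiding_hom_hom V W, HopfBimodule.braiding_hom_hom H, rfl, rfl,
      inferInstance⟩⟩
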